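/- Let $M$ be a smooth finite-dimensional manifold (Hausdorff, $\sigma$-compact, without boundary), $E\to M$ a smooth real vector bundle of finite rank $n$, and $\tau:E^*\to M$ its dual bundle. A Lie algebroid structure on a vector bundle $A\to M$ is a vector bundle map $\rho:A\to TM$ (the anchor) and a Lie bracket $[\![\cdot,\cdot]\!]$ on $\Gamma(A)$ with $\rho[\![X,Y]\!]=[\rho X,\rho Y]$ and $[\![X,fY]\!]=\rho(X)(f)\,Y+f[\![X,Y]\!]$ for $X,Y\in\Gamma(A)$, $f\in C^\infty(M)$. It is symplectic if there is a fibrewise non-degenerate two-form $\omega\in\Gamma(\bigwedge^2A^*)$ that is closed, i.e. for all $X,Y,Z\in\Gamma(A)$ $$\rho(X)\omega(Y,Z)-\rho(Y)\omega(X,Z)+\rho(Z)\omega(X,Y)-\omega([\![X,Y]\!],Z)+\omega([\![X,Z]\!],Y)-\omega([\![Y,Z]\!],X)=0 .$$ For a Lie algebroid $A\to M$, the prolongation $\mathcal T^{A}E^*\to E^*$ of $A$ over $\tau$ has the fibres $$\mathcal T^A_pE^*=\{(b,v)\in A_{\tau(p)}\times T_pE^*\;:\;\rho(b)=T_p\tau(v)\},\qquad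 p\in E^* .$$ Its smooth sections are the pairs $(\sigma,X)$ of a smooth section $\sigma$ of $\tau^*A$ and a smooth vector field $X$ on $E^*$ with values in these fibres. A prolongation Lie algebroid structure on it is one with anchor $(b,v)\mapsto v$ and with $$[\![(\sigma_1\circ\tau,X_1),(\sigma_2\circ\tau,X_2)]\!]=([\![\sigma_1,\sigma_2]\!]\circ\tau,[X_1,X_2])$$ for all sections of this form with $\sigma_1,\sigma_2\in\Gamma(A)$. Then: (i) If $E^*$ carries a symplectic Lie algebroid structure, then the prolongation $\mathfrak L^\tau_{E^*}=\mathcal T^{E^*}E^*$ of the Lie algebroid $A=E^*$ over $\tau:E^*\to M$ is symplectic. (ii) If $E$ carries a symplectic Lie algebroid structure, then the prolongation $\mathcal T^{E}E^*$ of the Lie algebroid $A=E$ over $\tau:E^*\to M$ is symplectic. In both cases "the prolongation is symplectic" means: it is a smooth vector bundle of rank $2n$ over $E^*$, it carries exactly one prolongation Lie algebroid structure, and this Lie algebroid is symplectic. -/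

import Mathlib

open Bundle VectorField
open scoped Manifold ContDiff Topology

noncomputable section

/-! ## Lie algebroids and their two-forms

A smooth vector bundle over `B` enters through its fibres `V b` and the space `Γ` of its global smooth
sections.  Below `Γ` is always one of two concrete spaces: the smooth sections of a smooth vector
bundle of Mathlib (`smoothSections`), or the smooth sections of a prolongation
(`prolongationSections`). -/

section LieAlgebroids

variable {EB : Type*} [NormedAddCommGroup EB] [NormedSpace ℝ EB] {HB : Type*} [TopologicalSpace HB]
  (J : ModelWithCorners ℝ EB HB) {B : Type*} [TopologicalSpace B] [ChartedSpace HB B]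
  [IsManifold J ∞ B]
  {V : B → Type*} [∀ b, AddCommGroup (V b)] [∀ b, Module ℝ (V b)]

/-- A Lie algebroid structure on the vector bundle with fibres `V b` and smooth sections `Γ`:
an anchor (a fibrewise linear, smooth map to the tangent bundle) and a Lie bracket on the sections
satisfying the Leibniz rule, such that the anchor is a morphism of Lie algebras to vector fields. -/
@[ext]
structure LieAlgebroid (Γ : Submodule ℝ (∀ b, V b)) where
  /-- the anchor -/
  anchor : ∀ b, V b →ₗ[ℝ] TangentSpace J b
  /-- the bracket of sections -/
  bracket : Γ →ₗ[ℝ] Γ →ₗ[ℝ] Γ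
  anchor_smooth : ∀ X : Γ,
    ContMDiff J J.tangent ∞ (fun b => (⟨b, anchor b (X.1 b)⟩ : TangentBundle J B))
  bracket_self : ∀ X : Γ, bracket X X = 0
  jacobi : ∀ X Y Z : Γ,
    bracket X (bracket Y Z) + bracket Y (bracket Z X) + bracket Z (bracket X Y) = 0
  anchor_bracket : ∀ (X Y : Γ) (b : B), anchor b ((bracket X Y).1 b) =
    mlieBracket J (fun c => anchor c (X.1 c)) (fun c => anchor c (Y.1 c)) b
  leibniz : ∀ (X Y fY : Γ) (f : B → ℝ), ContMDiff J 𝓘(ℝ, ℝ) ∞ f → (∀ b, fY.1 b = f b • Y.1 b) →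
    ∀ b, (bracket X fY).1 b =
      mvfderiv J f b (anchor b (X.1 b)) • Y.1 b + f b • (bracket X Y).1 b

/-- A smooth two-form on the bundle: a section of `⋀² V*`. -/
structure TwoForm (Γ : Submodule ℝ (∀ b, V b)) where
  /-- the value on two vectors of a fibre -/
  toFun : ∀ b, V b →ₗ[ℝ] V b →ₗ[ℝ] ℝ
  alternating : ∀ b v, toFun b v v = 0
  smooth : ∀ X Y : Γ, ContMDiff J 𝓘(ℝ, ℝ) ∞ (fun b => toFun b (X.1 b) (Y.1 b))

namespace TwoForm

variable {J} {Γ : Submodule ℝ (∀ b, V b)}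

/-- Fibrewise non-degeneracy. -/
def Nondegenerate (Ω : TwoForm J Γ) : Prop :=
  ∀ b (v : V b), (∀ w : V b, Ω.toFun b v w = 0) → v = 0

/-- The function `Ω(X, Y)`. -/
def eval (Ω : TwoForm J Γ) (X Y : Γ) : B → ℝ := fun b => Ω.toFun b (X.1 b) (Y.1 b)

end TwoForm

namespace LieAlgebroid

variable {J} {Γ : Submodule ℝ (∀ b, V b)}

/-- The derivative `ρ(X)(f)` of a function along a section. -/
def deriv (L : LieAlgebroid J Γ) (X : Γ) (f : B → ℝ) (b : B) : ℝ :=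
  mvfderiv J f b (L.anchor b (X.1 b))

/-- The Lie algebroid differential of a two-form, as a function of three sections. -/
def d (L : LieAlgebroid J Γ) (Ω : TwoForm J Γ) (X Y Z : Γ) (b : B) : ℝ :=
  L.deriv X (Ω.eval Y Z) b - L.deriv Y (Ω.eval X Z) b + L.deriv Z (Ω.eval X Y) b
    - Ω.eval (L.bracket X Y) Z b + Ω.eval (L.bracket X Z) Y b - Ω.eval (L.bracket Y Z) X b

/-- A symplectic section: a non-degenerate two-form that is closed for the differential of the
Lie algebroid. -/
def IsSymplecticSection (L : LieAlgebroid J Γ) (Ω : TwoForm J Γ) : Prop :=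
  Ω.Nondegenerate ∧ ∀ X Y Z : Γ, ∀ b, L.d Ω X Y Z b = 0

/-- A Lie algebroid is symplectic if it possesses a symplectic section. -/
def IsSymplectic (L : LieAlgebroid J Γ) : Prop :=
  ∃ Ω : TwoForm J Γ, L.IsSymplecticSection Ω

end LieAlgebroid

/-- The fibres `V b` form a smooth vector bundle of rank `r` with smooth sections `Γ`:
around every point there is a frame of sections in which all sections have smooth coefficients. -/
def IsSmoothBundleOfRank (Γ : Submodule ℝ (∀ b, V b)) (r : ℕ) : Prop :=
  ∀ b₀ : B, ∃ U : Set B, IsOpen U ∧ b₀ ∈ U ∧ ∃ e : Fin r → Γ,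
    (∀ b ∈ U, LinearIndependent ℝ (fun i => (e i).1 b) ∧
      Submodule.span ℝ (Set.range fun i => (e i).1 b) = ⊤) ∧
    ∀ X : Γ, ∃ c : Fin r → B → ℝ, (∀ i, ContMDiffOn J 𝓘(ℝ, ℝ) ∞ (c i) U) ∧
      ∀ b ∈ U, X.1 b = ∑ i, c i b • (e i).1 b

end LieAlgebroids

/-! ## Smooth sections of a vector bundle, and prolongations -/

section Prolongation

variable {EM : Type*} [NormedAddCommGroup EM] [NormedSpace ℝ EM] {HM : Type*} [TopologicalSpace HM]
  (I : ModelWithCorners ℝ EM HM) {M : Type*} [TopologicalSpace M] [ChartedSpace HM M]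
  [IsManifold I ∞ M]
  (F : Type*) [NormedAddCommGroup F] [NormedSpace ℝ F]
  (A : M → Type*) [TopologicalSpace (TotalSpace F A)] [∀ x, TopologicalSpace (A x)]
  [∀ x, AddCommGroup (A x)] [∀ x, Module ℝ (A x)]
  [FiberBundle F A] [VectorBundle ℝ F A] [ContMDiffVectorBundle ∞ F A I]

/-- The global smooth sections of a smooth vector bundle. -/
def smoothSections : Submodule ℝ (∀ x, A x) where
  carrier := {s | ContMDiff I (I.prod 𝓘(ℝ, F)) ∞ (fun x => (⟨x, s x⟩ : TotalSpace F A))}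
  add_mem' hs ht := ContMDiff.add_section hs ht
  zero_mem' := contMDiff_zeroSection ℝ A
  smul_mem' _ _ hs := ContMDiff.const_smul_section hs

/-- The dual vector bundle. -/
abbrev DualBundle (E : M → Type*) [∀ x, TopologicalSpace (E x)] [∀ x, AddCommGroup (E x)]
    [∀ x, Module ℝ (E x)] : M → Type _ :=
  fun x => E x →L[ℝ] Trivial M ℝ x

set_option linter.unusedSectionVars false in
/-- A linear combination of two smooth lifts to the total space of one map is smooth. -/
theorem contMDiff_lift_combination {EP : Type*} [NormedAddCommGroup EP] [NormedSpace ℝ EP]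
    {HP : Type*} [TopologicalSpace HP] (J : ModelWithCorners ℝ EP HP) {P : Type*}
    [TopologicalSpace P] [ChartedSpace HP P] (τ : P → M) (a c : ℝ) (s t : ∀ p, A (τ p))
    (hs : ContMDiff J (I.prod 𝓘(ℝ, F)) ∞ (fun p => (⟨τ p, s p⟩ : TotalSpace F A)))
    (ht : ContMDiff J (I.prod 𝓘(ℝ, F)) ∞ (fun p => (⟨τ p, t p⟩ : TotalSpace F A))) :
    ContMDiff J (I.prod 𝓘(ℝ, F)) ∞
      (fun p => (⟨τ p, a • s p + c • t p⟩ : TotalSpace F A)) := by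
  intro p₀
  have hs' := contMDiffAt_totalSpace.1 (hs p₀)
  have ht' := contMDiffAt_totalSpace.1 (ht p₀)
  refine contMDiffAt_totalSpace.2 ⟨hs'.1, ?_⟩
  refine (((contMDiffAt_const (I := J) (I' := 𝓘(ℝ, ℝ)) (c := a)).smul hs'.2).add
    ((contMDiffAt_const (I := J) (I' := 𝓘(ℝ, ℝ)) (c := c)).smul ht'.2)).congr_of_eventuallyEq ?_
  have hb : ∀ᶠ p in 𝓝 p₀, τ p ∈ (trivializationAt F A (τ p₀)).baseSet :=
    hs'.1.continuousAt.eventually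
      ((trivializationAt F A (τ p₀)).open_baseSet.mem_nhds (mem_baseSet_trivializationAt F A _))
  filter_upwards [hb] with p hp
  have h := (trivializationAt F A (τ p₀)).linear ℝ hp
  simp [h.map_add, h.map_smul]

variable {I F A}
variable {EP : Type*} [NormedAddCommGroup EP] [NormedSpace ℝ EP] {HP : Type*} [TopologicalSpace HP]
  (J : ModelWithCorners ℝ EP HP) {P : Type*} [TopologicalSpace P] [ChartedSpace HP P]
  [IsManifold J ∞ P]

/-- The fibre at `p` of the prolongation of the Lie algebroid `A` over `τ : P → M`:
the pairs `(b, v)` with `b ∈ A_{τ(p)}`, `v ∈ T_p P` and `ρ(b) = T_p τ (v)`. -/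
def prolongationFiber (L : LieAlgebroid I (smoothSections I F A)) (τ : P → M) (p : P) :
    Submodule ℝ (A (τ p) × TangentSpace J p) :=
  LinearMap.eqLocus ((L.anchor (τ p)) ∘ₗ LinearMap.fst ℝ (A (τ p)) (TangentSpace J p))
    ((mfderiv J I τ p).toLinearMap ∘ₗ LinearMap.snd ℝ (A (τ p)) (TangentSpace J p))

/-- The smooth sections of the prolongation, a subbundle of `τ^*A ⊕ TP`: both components
are smooth. -/
def prolongationSections (L : LieAlgebroid I (smoothSections I F A)) (τ : P → M)
    (hτ : ContMDiff J I ∞ τ) : Submodule ℝ (∀ p, prolongationFiber J L τ p) where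
  carrier := {S |
    ContMDiff J (I.prod 𝓘(ℝ, F)) ∞ (fun p => (⟨τ p, (S p).1.1⟩ : TotalSpace F A)) ∧
    ContMDiff J J.tangent ∞ (fun p => (⟨p, (S p).1.2⟩ : TangentBundle J P))}
  add_mem' {S T} hS hT := by
    refine ⟨?_, ContMDiff.add_section hS.2 hT.2⟩
    simpa using contMDiff_lift_combination I F A J τ 1 1 _ _ hS.1 hT.1
  zero_mem' := ⟨(contMDiff_zeroSection ℝ A).comp hτ, contMDiff_zeroSection ℝ _⟩
  smul_mem' a S hS := by
    refine ⟨?_, ContMDiff.const_smul_section hS.2⟩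
    simpa using contMDiff_lift_combination I F A J τ a 0 _ _ hS.1 hS.1

/-- `K` is the prolongation Lie algebroid of `L` over `τ`: its anchor is `(b, v) ↦ v`, and the
bracket of two sections projectable onto sections `σ₁, σ₂` of `A` is
`[(σ₁, X₁), (σ₂, X₂)] = ([σ₁, σ₂], [X₁, X₂])`. -/
structure IsProlongation (L : LieAlgebroid I (smoothSections I F A)) (τ : P → M)
    (hτ : ContMDiff J I ∞ τ) (K : LieAlgebroid J (prolongationSections J L τ hτ)) : Prop where
  anchor_eq : ∀ p z, K.anchor p z = z.1.2
  bracket_eq : ∀ (S₁ S₂ : prolongationSections J L τ hτ) (σ₁ σ₂ : smoothSections I F A),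
    (∀ p, (S₁.1 p).1.1 = σ₁.1 (τ p)) → (∀ p, (S₂.1 p).1.1 = σ₂.1 (τ p)) →
    ∀ p, ((K.bracket S₁ S₂).1 p).1 = ((L.bracket σ₁ σ₂).1 (τ p),
      mlieBracket J (fun q => (S₁.1 q).1.2) (fun q => (S₂.1 q).1.2) p)

/-- The prolongation of `L` over `τ : P → M` is symplectic: its fibres form a smooth vector
bundle over `P` of rank `r`, there is exactly one prolongation Lie algebroid structure on it, and
this Lie algebroid is symplectic. -/
def HasSymplecticProlongation (L : LieAlgebroid I (smoothSections I F A)) (τ : P → M)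
    (hτ : ContMDiff J I ∞ τ) (r : ℕ) : Prop :=
  IsSmoothBundleOfRank J (prolongationSections J L τ hτ) r ∧
    ∃ K : LieAlgebroid J (prolongationSections J L τ hτ), IsProlongation J L τ hτ K ∧
      (∀ K', IsProlongation J L τ hτ K' → K' = K) ∧ K.IsSymplectic

end Prolongation

end

noncomputable section

set_option linter.unusedSectionVars false

/-! ## Derivatives of functions along vector fields -/

section VectorFields

variable {EB : Type*} [NormedAddCommGroup EB] [NormedSpace ℝ EB] {HB : Type*} [TopologicalSpace HB]
  {J : ModelWithCorners ℝ EB HB} {B : Type*} [TopologicalSpace B] [ChartedSpace HB B]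

/-! Both statements are instances of one construction. Let W → M be a vector bundle, A → M a Lie
algebroid and β a smooth, fibrewise non-degenerate pairing of W with A. The prolongation of A over W
carries the Liouville one-form λ_p(b, v) = β(p, b), and Ω = dλ is symplectic
(`hasSymplecticProlongation_of_pairing`). For (i), W = A = E* and β = ω; for (ii), W = E*, A = E and
β is evaluation.

Closedness is d² = 0 (`LieAlgebroid.d_eq_zero_of_exact`). Non-degeneracy rests on Ω(z, (0, wᵛ)) =
-β(w, z₁), where wᵛ is the vertical lift of w and z₁ the A-component of z
(`pairingForm_eval_vertical`). If z is in the kernel, then z₁ = 0, so z is itself vertical, z = (0,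
wᵛ). Pairing it with vectors over every b in A gives β(w, b) = 0, hence w = 0.

The prolongation algebroid itself has to be constructed. Second components are bracketed as vector
fields. The first component is Cartan's formula read backwards: for one-forms a on A, a([S, T]₁) =
X_S(a(T₁)) - X_T(a(S₁)) - da(S₁, T₁). The right side is function-linear in a
(`isTensorialAt_bracketForm`), hence evaluation at a vector. The Leibniz rule makes the Jacobiator
tensorial, so the Jacobi identity need only be checked on frames of projectable sections, where it
is that of A together with that of vector fields. The same reduction to frames gives uniqueness.

The pointwise arguments use cut-off frames: sections e_i and one-forms α_i with ∑ α_i ⊗ e_i = χ · id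
and χ(b₀) = 1. They are global because brackets are defined on global sections only. -/

theorem ContMDiff.mdifferentiableAt_of_smooth {EN HN N : Type*} [NormedAddCommGroup EN]
    [NormedSpace ℝ EN] [TopologicalSpace HN] {JN : ModelWithCorners ℝ EN HN} [TopologicalSpace N]
    [ChartedSpace HN N] {f : B → N} (hf : ContMDiff J JN ∞ f) (b : B) :
    MDifferentiableAt J JN f b :=
  (hf b).mdifferentiableAt (by simp)

variable [IsManifold J ∞ B]

/-- The derivative of a smooth function along a smooth vector field is smooth. -/
theorem contMDiff_mvfderiv_apply {X : ∀ b, TangentSpace J b} {f : B → ℝ}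
    (hX : ContMDiff J J.tangent ∞ (fun b => (⟨b, X b⟩ : TangentBundle J B)))
    (hf : ContMDiff J 𝓘(ℝ, ℝ) ∞ f) :
    ContMDiff J 𝓘(ℝ, ℝ) ∞ (fun b => mvfderiv J f b (X b)) :=
  (contMDiff_snd_tangentBundle_modelSpace ℝ 𝓘(ℝ, ℝ)).comp
    ((hf.contMDiff_tangentMap (m := ∞) (by simp)).comp hX)

omit [IsManifold J ∞ B] in
theorem mvfderiv_mul_apply {f g : B → ℝ} (hf : ContMDiff J 𝓘(ℝ, ℝ) ∞ f)
    (hg : ContMDiff J 𝓘(ℝ, ℝ) ∞ g) (b : B) (v : TangentSpace J b) :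
    mvfderiv J (fun c => f c * g c) b v = mvfderiv J f b v * g b + f b * mvfderiv J g b v := by
  rw [mvfderiv_fun_mul (hf.mdifferentiableAt_of_smooth b) (hg.mdifferentiableAt_of_smooth b)]
  simp; ring

omit [IsManifold J ∞ B] in
theorem mvfderiv_add_apply {f g : B → ℝ} (hf : ContMDiff J 𝓘(ℝ, ℝ) ∞ f)
    (hg : ContMDiff J 𝓘(ℝ, ℝ) ∞ g) (b : B) (v : TangentSpace J b) :
    mvfderiv J (fun c => f c + g c) b v = mvfderiv J f b v + mvfderiv J g b v := by
  rw [mvfderiv_fun_add (hf.mdifferentiableAt_of_smooth b) (hg.mdifferentiableAt_of_smooth b)]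
  simp

omit [IsManifold J ∞ B] in
theorem mvfderiv_sub_apply {f g : B → ℝ} (hf : ContMDiff J 𝓘(ℝ, ℝ) ∞ f)
    (hg : ContMDiff J 𝓘(ℝ, ℝ) ∞ g) (b : B) (v : TangentSpace J b) :
    mvfderiv J (fun c => f c - g c) b v = mvfderiv J f b v - mvfderiv J g b v := by
  rw [mvfderiv_fun_sub (hf.mdifferentiableAt_of_smooth b) (hg.mdifferentiableAt_of_smooth b)]
  simp

omit [IsManifold J ∞ B] in
theorem mvfderiv_const_apply (a : ℝ) (b : B) (v : TangentSpace J b) :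
    mvfderiv J (fun _ => a) b v = 0 := by
  rw [mvfderiv_const]; simp

omit [IsManifold J ∞ B] in
theorem mvfderiv_const_mul_apply (a : ℝ) {f : B → ℝ} (hf : ContMDiff J 𝓘(ℝ, ℝ) ∞ f)
    (b : B) (v : TangentSpace J b) :
    mvfderiv J (fun c => a * f c) b v = a * mvfderiv J f b v := by
  rw [mvfderiv_mul_apply contMDiff_const hf, mvfderiv_const_apply]; simp

variable [CompleteSpace EB]

omit [CompleteSpace EB] in
theorem isManifold_minSmoothness (n : ℕ∞ω) [ENat.LEInfty n] :
    IsManifold J (minSmoothness ℝ n) B := by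
  simp only [minSmoothness_of_isRCLikeNormedField]
  exact IsManifold.of_le (n := ∞) ENat.LEInfty.out

theorem contMDiff_mlieBracket {X Y : ∀ b, TangentSpace J b}
    (hX : ContMDiff J J.tangent ∞ (fun b => (⟨b, X b⟩ : TangentBundle J B)))
    (hY : ContMDiff J J.tangent ∞ (fun b => (⟨b, Y b⟩ : TangentBundle J B))) :
    ContMDiff J J.tangent ∞ (fun b => (⟨b, mlieBracket J X Y b⟩ : TangentBundle J B)) := by
  have : IsManifold J (((⊤ : ℕ∞) : WithTop ℕ∞) + 1) B := by simpa using ‹IsManifold J ∞ B›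
  have : IsManifold J (minSmoothness ℝ 2) B := isManifold_minSmoothness 2
  have : IsManifold J (minSmoothness ℝ 3) B := isManifold_minSmoothness 3
  exact fun b => ContMDiffAt.mlieBracket_vectorField (n := ⊤) (m := ⊤) (hX b) (hY b) (by simp)

theorem mlieBracket_jacobi {X Y Z : ∀ b, TangentSpace J b} {b : B}
    (hX : ContMDiffAt J J.tangent ∞ (fun b => (⟨b, X b⟩ : TangentBundle J B)) b)
    (hY : ContMDiffAt J J.tangent ∞ (fun b => (⟨b, Y b⟩ : TangentBundle J B)) b)
    (hZ : ContMDiffAt J J.tangent ∞ (fun b => (⟨b, Z b⟩ : TangentBundle J B)) b) :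
    mlieBracket J X (mlieBracket J Y Z) b =
      mlieBracket J (mlieBracket J X Y) Z b + mlieBracket J Y (mlieBracket J X Z) b := by
  have : IsManifold J (minSmoothness ℝ 3) B := isManifold_minSmoothness 3
  have h2 : minSmoothness ℝ 2 ≤ ∞ := by
    simp only [minSmoothness_of_isRCLikeNormedField]
    exact ENat.LEInfty.out
  exact leibniz_identity_mlieBracket_apply (hX.of_le h2) (hY.of_le h2) (hZ.of_le h2)

/-- The Lie bracket of smooth vector fields acts on functions as the commutator. -/
theorem mvfderiv_mlieBracket_apply {X Y : ∀ b, TangentSpace J b} {f : B → ℝ}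
    (hX : ContMDiff J J.tangent ∞ (fun b => (⟨b, X b⟩ : TangentBundle J B)))
    (hY : ContMDiff J J.tangent ∞ (fun b => (⟨b, Y b⟩ : TangentBundle J B)))
    (hf : ContMDiff J 𝓘(ℝ, ℝ) ∞ f) (b : B) :
    mvfderiv J f b (mlieBracket J X Y b) =
      mvfderiv J (fun c => mvfderiv J f c (Y c)) b (X b) -
        mvfderiv J (fun c => mvfderiv J f c (X c)) b (Y b) := by
  have : IsManifold J (((⊤ : ℕ∞) : WithTop ℕ∞) + 1) B := by simpa using ‹IsManifold J ∞ B›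
  have : IsManifold J (minSmoothness ℝ 2) B := isManifold_minSmoothness 2
  have : IsManifold J (minSmoothness ℝ 3) B := isManifold_minSmoothness 3
  -- A chart-free argument: apply the Jacobi identity to X, Y and f • Z, where Z is a local
  -- extension of u. After expansion by the Leibniz rule, the identity for X, Y, Z removes all
  -- brackets of Z, and the remaining coefficient of u is the claim.
  have key : ∀ u : TangentSpace J b, (mvfderiv J f b (mlieBracket J X Y b) -
      (mvfderiv J (fun c => mvfderiv J f c (Y c)) b (X b) -
        mvfderiv J (fun c => mvfderiv J f c (X c)) b (Y b))) • u = 0 := by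
    intro u
    obtain ⟨s, hs, hsm⟩ := FiberBundle.exists_contMDiffOn_extend (k := ∞) J EB u
    set Z : ∀ c, TangentSpace J c := FiberBundle.extend EB u with hZdef
    have hZu : Z b = u := by simp [hZdef]
    have hZev : ∀ᶠ c in 𝓝 b,
        ContMDiffAt J J.tangent ∞ (fun b => (⟨b, Z b⟩ : TangentBundle J B)) c := by
      filter_upwards [eventually_mem_nhds_iff.2 hs] with c hc
      exact (hsm c (mem_of_mem_nhds hc)).contMDiffAt hc
    have hZ := hZev.self_of_nhds
    have md : ∀ {c} {W : ∀ b, TangentSpace J b},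
        ContMDiffAt J J.tangent ∞ (fun b => (⟨b, W b⟩ : TangentBundle J B)) c →
        MDifferentiableAt J J.tangent (fun b => (⟨b, W b⟩ : TangentBundle J B)) c :=
      fun h => h.mdifferentiableAt (by simp)
    have br : ∀ {c} {W W' : ∀ b, TangentSpace J b},
        ContMDiffAt J J.tangent ∞ (fun b => (⟨b, W b⟩ : TangentBundle J B)) c →
        ContMDiffAt J J.tangent ∞ (fun b => (⟨b, W' b⟩ : TangentBundle J B)) c →
        ContMDiffAt J J.tangent ∞ (fun b => (⟨b, mlieBracket J W W' b⟩ : TangentBundle J B)) c :=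
      fun h h' => ContMDiffAt.mlieBracket_vectorField (n := ⊤) (m := ⊤) h h' (by simp)
    have sm : ∀ {c} {W : ∀ b, TangentSpace J b} {g : B → ℝ}, ContMDiff J 𝓘(ℝ, ℝ) ∞ g →
        ContMDiffAt J J.tangent ∞ (fun b => (⟨b, W b⟩ : TangentBundle J B)) c →
        ContMDiffAt J J.tangent ∞ (fun b => (⟨b, (g • W) b⟩ : TangentBundle J B)) c :=
      fun hg h => ContMDiffAt.smul_section (hg _) h
    have leib : ∀ {U : ∀ b, TangentSpace J b}, mlieBracket J U (f • Z) =ᶠ[𝓝 b]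
        (fun c => mvfderiv J f c (U c)) • Z + f • mlieBracket J U Z := by
      intro U
      filter_upwards [hZev] with c hc
      exact mlieBracket_smul_right (hf.mdifferentiableAt_of_smooth c) (md hc)
    have expand : ∀ {U V : ∀ b, TangentSpace J b},
        ContMDiff J J.tangent ∞ (fun b => (⟨b, V b⟩ : TangentBundle J B)) →
        mlieBracket J U (mlieBracket J V (f • Z)) b =
        mvfderiv J (fun c => mvfderiv J f c (V c)) b (U b) • Z b +
          mvfderiv J f b (V b) • mlieBracket J U Z b +
          (mvfderiv J f b (U b) • mlieBracket J V Z b +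
            f b • mlieBracket J U (mlieBracket J V Z) b) := by
      intro U V hV
      have hVf := contMDiff_mvfderiv_apply hV hf
      rw [Filter.EventuallyEq.mlieBracket_vectorField_eq (Filter.EventuallyEq.refl _ U) leib,
        mlieBracket_add_right (md (sm hVf hZ)) (md (sm hf (br (hV b) hZ))),
        mlieBracket_smul_right (hVf.mdifferentiableAt_of_smooth b) (md hZ),
        mlieBracket_smul_right (hf.mdifferentiableAt_of_smooth b) (md (br (hV b) hZ))]
    have jac := mlieBracket_jacobi (hX b) (hY b) (sm hf hZ)
    rw [expand hY, expand hX, leib.self_of_nhds, Pi.add_apply, Pi.smul_apply', Pi.smul_apply',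
      mlieBracket_jacobi (hX b) (hY b) hZ, hZu] at jac
    rw [← neg_eq_zero, ← sub_eq_zero.2 jac]
    module
  -- Cancelling u needs a nonzero vector; over a zero tangent space both sides vanish.
  by_cases h : ∃ u : TangentSpace J b, u ≠ 0
  · obtain ⟨u, hu⟩ := h
    exact sub_eq_zero.1 ((smul_eq_zero.1 (key u)).resolve_right hu)
  · push Not at h
    rw [h (mlieBracket J X Y b), h (X b), h (Y b)]
    simp

end VectorFields

/-! ## Modules of sections with local frames -/

section Frames

variable {EB : Type*} [NormedAddCommGroup EB] [NormedSpace ℝ EB] {HB : Type*} [TopologicalSpace HB]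
  (J : ModelWithCorners ℝ EB HB) {B : Type*} [TopologicalSpace B] [ChartedSpace HB B]
  {V : B → Type*} [∀ b, AddCommGroup (V b)] [∀ b, Module ℝ (V b)]

/-- A fibrewise linear functional which is smooth on all sections in `Γ`. -/
def IsSmoothOneForm (Γ : Submodule ℝ (∀ b, V b)) (a : ∀ b, V b →ₗ[ℝ] ℝ) : Prop :=
  ∀ X : Γ, ContMDiff J 𝓘(ℝ, ℝ) ∞ (fun b => a b (X.1 b))

/-- A cut-off frame at `b₀`: global sections `e i` and smooth one-forms `α i` such that
`∑ i, α i ⊗ e i` is multiplication by a smooth function with value one at `b₀`. -/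
structure CutoffFrame (Γ : Submodule ℝ (∀ b, V b)) (b₀ : B) where
  /-- the index type -/
  ι : Type
  [fintype : Fintype ι]
  /-- the cut-off function -/
  χ : B → ℝ
  /-- the sections -/
  e : ι → Γ
  /-- the one-forms -/
  α : ι → ∀ b, V b →ₗ[ℝ] ℝ
  χ_smooth : ContMDiff J 𝓘(ℝ, ℝ) ∞ χ
  χ_eq_one : χ b₀ = 1
  α_smooth : ∀ i, IsSmoothOneForm J Γ (α i)
  smul_eq : ∀ b v, χ b • v = ∑ i, α i b v • (e i).1 b

attribute [instance] CutoffFrame.fintype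

/-- A space of sections closed under multiplication by smooth functions and possessing cut-off
frames at all points. -/
structure HasCutoffFrames (Γ : Submodule ℝ (∀ b, V b)) : Prop where
  smul_mem : ∀ f : B → ℝ, ContMDiff J 𝓘(ℝ, ℝ) ∞ f → ∀ X ∈ Γ, (fun b => f b • X b) ∈ Γ
  frame : ∀ b₀, Nonempty (CutoffFrame J Γ b₀)

variable {J} {Γ : Submodule ℝ (∀ b, V b)}

/-- The product of a smooth function and a section. -/
def HasCutoffFrames.smul (hΓ : HasCutoffFrames J Γ) (f : B → ℝ) (hf : ContMDiff J 𝓘(ℝ, ℝ) ∞ f)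
    (X : Γ) : Γ :=
  ⟨fun b => f b • X.1 b, hΓ.smul_mem f hf X.1 X.2⟩

/-- A linear map on sections which is linear over the smooth functions with respect to
evaluation at `b₀`. -/
def IsTensorialAt (J : ModelWithCorners ℝ EB HB) (b₀ : B) {Y : Type*} [AddCommGroup Y] [Module ℝ Y]
    (Φ : Γ →ₗ[ℝ] Y) : Prop :=
  ∀ f : B → ℝ, ContMDiff J 𝓘(ℝ, ℝ) ∞ f → ∀ X fX : Γ, (∀ b, fX.1 b = f b • X.1 b) →
    Φ fX = f b₀ • Φ X

namespace CutoffFrame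

variable {b₀ : B} (φ : CutoffFrame J Γ b₀)

theorem eq_sum (v : V b₀) : v = ∑ i, φ.α i b₀ v • (φ.e i).1 b₀ := by
  rw [← φ.smul_eq, φ.χ_eq_one, one_smul]

/-- Multiplying X by χ does not change Φ X, because χ(b₀) = 1, and χX is the global combination ∑
α_i(X) e_i, whose coefficients tensoriality pulls out. This makes Φ depend only on the value of X at
b₀. -/
theorem apply_eq_sum (hΓ : HasCutoffFrames J Γ) {Y : Type*} [AddCommGroup Y] [Module ℝ Y]
    {Φ : Γ →ₗ[ℝ] Y} (hΦ : IsTensorialAt J b₀ Φ) (X : Γ) :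
    Φ X = ∑ i, φ.α i b₀ (X.1 b₀) • Φ (φ.e i) := by
  have h1 : Φ (hΓ.smul φ.χ φ.χ_smooth X) = Φ X := by
    rw [hΦ φ.χ φ.χ_smooth X _ (fun _ => rfl), φ.χ_eq_one, one_smul]
  have h2 : hΓ.smul φ.χ φ.χ_smooth X =
      ∑ i, hΓ.smul (fun b => φ.α i b (X.1 b)) (φ.α_smooth i X) (φ.e i) := by
    ext b
    simp only [HasCutoffFrames.smul, Submodule.coe_sum, Finset.sum_apply]
    exact φ.smul_eq b _
  rw [← h1, h2, map_sum]
  exact Finset.sum_congr rfl fun i _ => hΦ _ (φ.α_smooth i X) _ _ fun _ => rfl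

theorem eq_zero (hΓ : HasCutoffFrames J Γ) {Y : Type*} [AddCommGroup Y] [Module ℝ Y]
    {Φ : Γ →ₗ[ℝ] Y} (hΦ : IsTensorialAt J b₀ Φ) (h : ∀ i, Φ (φ.e i) = 0) (X : Γ) : Φ X = 0 := by
  rw [φ.apply_eq_sum hΓ hΦ]
  simp [h]

/-- The extension of a vector at `b₀` to a section by means of a frame. -/
def extend (v : V b₀) : Γ := ∑ i, φ.α i b₀ v • φ.e i

theorem extend_apply (v : V b₀) : (φ.extend v).1 b₀ = v := by
  conv_rhs => rw [φ.eq_sum v]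
  simp [extend, Finset.sum_apply]

end CutoffFrame

/-- Two sections with the same value at `b₀` have the same image under a tensorial map. -/
theorem IsTensorialAt.congr {b₀ : B} (hΓ : HasCutoffFrames J Γ) {Y : Type*} [AddCommGroup Y]
    [Module ℝ Y] {Φ : Γ →ₗ[ℝ] Y} (hΦ : IsTensorialAt J b₀ Φ) {X X' : Γ}
    (h : X.1 b₀ = X'.1 b₀) : Φ X = Φ X' := by
  obtain ⟨φ⟩ := hΓ.frame b₀
  rw [φ.apply_eq_sum hΓ hΦ, φ.apply_eq_sum hΓ hΦ, h]

/-- A bilinear map on sections with values in functions which is tensorial and alternating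
comes from a two-form. -/
theorem exists_twoForm (hΓ : HasCutoffFrames J Γ) (Φ : Γ →ₗ[ℝ] Γ →ₗ[ℝ] (B → ℝ))
    (hself : ∀ X, Φ X X = 0)
    (hΦ : ∀ X b, IsTensorialAt J b (LinearMap.proj b ∘ₗ Φ X))
    (hsm : ∀ X Y, ContMDiff J 𝓘(ℝ, ℝ) ∞ (Φ X Y)) :
    ∃ Ω : TwoForm J Γ, ∀ X Y, Ω.eval X Y = Φ X Y := by
  have hswap : ∀ X Y, Φ X Y = -Φ Y X := fun X Y => by
    have h := hself (X + Y)
    simp only [map_add, LinearMap.add_apply, hself, zero_add, add_zero] at h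
    exact eq_neg_of_add_eq_zero_right h
  -- The form is evaluated on extensions of the two vectors by a frame chosen separately at each
  -- point. By `hcongr` the value depends only on the vectors, so smoothness can be read off from Φ
  -- X Y although the choices do not vary smoothly.
  let φ : ∀ b, CutoffFrame J Γ b := fun b => (hΓ.frame b).some
  have hcongr : ∀ b (X X' Y Y' : Γ), X.1 b = X'.1 b → Y.1 b = Y'.1 b →
      Φ X Y b = Φ X' Y' b := by
    intro b X X' Y Y' hX hY
    have h1 : Φ X Y b = Φ X Y' b := (hΦ X b).congr hΓ hY
    have h2 : Φ Y' X b = Φ Y' X' b := (hΦ Y' b).congr hΓ hX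
    rw [h1, hswap X, hswap X', Pi.neg_apply, Pi.neg_apply, h2]
  refine ⟨⟨fun b => LinearMap.mk₂ ℝ (fun v w => Φ ((φ b).extend v) ((φ b).extend w) b)
    ?_ ?_ ?_ ?_, ?_, ?_⟩, ?_⟩
  · intro v v' w
    rw [← Pi.add_apply, ← LinearMap.add_apply, ← map_add]
    exact hcongr b _ _ _ _ (by simp [CutoffFrame.extend_apply]) rfl
  · intro c v w
    rw [← Pi.smul_apply, ← LinearMap.smul_apply, ← map_smul]
    exact hcongr b _ _ _ _ (by simp [CutoffFrame.extend_apply]) rfl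
  · intro v w w'
    rw [← Pi.add_apply, ← map_add]
    exact hcongr b _ _ _ _ rfl (by simp [CutoffFrame.extend_apply])
  · intro c v w
    rw [← Pi.smul_apply, ← map_smul]
    exact hcongr b _ _ _ _ rfl (by simp [CutoffFrame.extend_apply])
  · intro b v
    simp [hself]
  · intro X Y
    convert hsm X Y using 2
    exact hcongr _ _ _ _ _ ((φ _).extend_apply _) ((φ _).extend_apply _)
  · intro X Y
    ext b
    exact hcongr _ _ _ _ _ ((φ _).extend_apply _) ((φ _).extend_apply _)

end Frames

/-! ## Calculus on Lie algebroids -/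

namespace LieAlgebroid

variable {EB : Type*} [NormedAddCommGroup EB] [NormedSpace ℝ EB] {HB : Type*} [TopologicalSpace HB]
  {J : ModelWithCorners ℝ EB HB} {B : Type*} [TopologicalSpace B] [ChartedSpace HB B]
  [IsManifold J ∞ B]
  {V : B → Type*} [∀ b, AddCommGroup (V b)] [∀ b, Module ℝ (V b)]
  {Γ : Submodule ℝ (∀ b, V b)} (L : LieAlgebroid J Γ)

theorem bracket_swap (X Y : Γ) : L.bracket X Y = -L.bracket Y X := by
  have h := L.bracket_self (X + Y)
  simp only [map_add, LinearMap.add_apply, L.bracket_self, zero_add, add_zero] at h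
  exact eq_neg_of_add_eq_zero_right h

theorem contMDiff_deriv (X : Γ) {f : B → ℝ} (hf : ContMDiff J 𝓘(ℝ, ℝ) ∞ f) :
    ContMDiff J 𝓘(ℝ, ℝ) ∞ (L.deriv X f) :=
  contMDiff_mvfderiv_apply (L.anchor_smooth X) hf

theorem deriv_add_left (X Y : Γ) (f : B → ℝ) : L.deriv (X + Y) f = L.deriv X f + L.deriv Y f := by
  ext b; simp [deriv]

theorem deriv_smul_left (c : ℝ) (X : Γ) (f : B → ℝ) : L.deriv (c • X) f = c • L.deriv X f := by
  ext b; simp [deriv]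

theorem deriv_smul_function {f : B → ℝ} {X fX : Γ} (h : ∀ b, fX.1 b = f b • X.1 b)
    (g : B → ℝ) (b : B) : L.deriv fX g b = f b * L.deriv X g b := by
  simp [deriv, h]

theorem deriv_add (X : Γ) {f g : B → ℝ} (hf : ContMDiff J 𝓘(ℝ, ℝ) ∞ f)
    (hg : ContMDiff J 𝓘(ℝ, ℝ) ∞ g) : L.deriv X (f + g) = L.deriv X f + L.deriv X g := by
  ext b; exact mvfderiv_add_apply hf hg b _

theorem deriv_sub (X : Γ) {f g : B → ℝ} (hf : ContMDiff J 𝓘(ℝ, ℝ) ∞ f)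
    (hg : ContMDiff J 𝓘(ℝ, ℝ) ∞ g) : L.deriv X (f - g) = L.deriv X f - L.deriv X g := by
  ext b; exact mvfderiv_sub_apply hf hg b _

theorem deriv_const_smul (X : Γ) (c : ℝ) {f : B → ℝ} (hf : ContMDiff J 𝓘(ℝ, ℝ) ∞ f) :
    L.deriv X (c • f) = c • L.deriv X f := by
  ext b; exact mvfderiv_const_mul_apply c hf b _

theorem deriv_mul (X : Γ) {f g : B → ℝ} (hf : ContMDiff J 𝓘(ℝ, ℝ) ∞ f)
    (hg : ContMDiff J 𝓘(ℝ, ℝ) ∞ g) (b : B) :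
    L.deriv X (fun c => f c * g c) b = L.deriv X f b * g b + f b * L.deriv X g b :=
  mvfderiv_mul_apply hf hg b _

theorem deriv_bracket [CompleteSpace EB] (X Y : Γ) {f : B → ℝ} (hf : ContMDiff J 𝓘(ℝ, ℝ) ∞ f) :
    L.deriv (L.bracket X Y) f = L.deriv X (L.deriv Y f) - L.deriv Y (L.deriv X f) := by
  ext b
  rw [deriv, L.anchor_bracket]
  exact mvfderiv_mlieBracket_apply (L.anchor_smooth X) (L.anchor_smooth Y) hf b

/-- The differential of a one-form, as a bilinear map on sections. -/
def dOneForm (a : ∀ b, V b →ₗ[ℝ] ℝ) (ha : IsSmoothOneForm J Γ a) : Γ →ₗ[ℝ] Γ →ₗ[ℝ] (B → ℝ) :=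
  LinearMap.mk₂ ℝ (fun X Y => L.deriv X (fun b => a b (Y.1 b)) - L.deriv Y (fun b => a b (X.1 b)) -
      fun b => a b ((L.bracket X Y).1 b))
    (by
      intro X X' Y
      have h : (fun b => a b ((X + X').1 b)) = (fun b => a b (X.1 b)) + fun b => a b (X'.1 b) := by
        ext b; simp
      rw [h, L.deriv_add Y (ha X) (ha X'), deriv_add_left]
      ext b; simp; ring)
    (by
      intro c X Y
      have h : (fun b => a b ((c • X).1 b)) = c • fun b => a b (X.1 b) := by
        ext b; simp
      rw [h, L.deriv_const_smul Y c (ha X), deriv_smul_left]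
      ext b; simp; ring)
    (by
      intro X Y Y'
      have h : (fun b => a b ((Y + Y').1 b)) = (fun b => a b (Y.1 b)) + fun b => a b (Y'.1 b) := by
        ext b; simp
      rw [h, L.deriv_add X (ha Y) (ha Y'), deriv_add_left]
      ext b; simp; ring)
    (by
      intro c X Y
      have h : (fun b => a b ((c • Y).1 b)) = c • fun b => a b (Y.1 b) := by
        ext b; simp
      rw [h, L.deriv_const_smul X c (ha Y), deriv_smul_left]
      ext b; simp; ring)

theorem dOneForm_apply {a : ∀ b, V b →ₗ[ℝ] ℝ} (ha : IsSmoothOneForm J Γ a) (X Y : Γ) :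
    L.dOneForm a ha X Y = L.deriv X (fun b => a b (Y.1 b)) - L.deriv Y (fun b => a b (X.1 b)) -
      fun b => a b ((L.bracket X Y).1 b) := rfl

/-- Replacing Y by fY produces ρ(X)(f) a(Y) twice, once from the product rule and once, with the
opposite sign, from the Leibniz rule of the bracket. What remains is tensorial. -/
theorem exists_twoForm_eval_eq (hΓ : HasCutoffFrames J Γ) {a : ∀ b, V b →ₗ[ℝ] ℝ}
    (ha : IsSmoothOneForm J Γ a) :
    ∃ Ω : TwoForm J Γ, ∀ X Y, Ω.eval X Y = L.dOneForm a ha X Y := by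
  refine exists_twoForm hΓ _ ?_ ?_ ?_
  · intro X
    rw [dOneForm_apply, L.bracket_self]
    ext b; simp
  · intro X b f hf Y fY h
    have h' : (fun b => a b (fY.1 b)) = fun b => f b * a b (Y.1 b) := by
      ext b; simp [h]
    simp only [LinearMap.comp_apply, LinearMap.proj_apply, dOneForm_apply, Pi.sub_apply, h']
    rw [L.deriv_mul X hf (ha Y), L.deriv_smul_function h, L.leibniz X Y fY f hf h b]
    simp only [map_add, map_smul, smul_eq_mul, deriv]
    ring
  · intro X Y
    exact ((L.contMDiff_deriv X (ha Y)).sub (L.contMDiff_deriv Y (ha X))).sub (ha _)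

/-- An exact two-form is closed. -/
theorem d_eq_zero_of_exact [CompleteSpace EB] {a : ∀ b, V b →ₗ[ℝ] ℝ} (ha : IsSmoothOneForm J Γ a)
    {Ω : TwoForm J Γ} (hΩ : ∀ X Y, Ω.eval X Y = L.dOneForm a ha X Y) (X Y Z : Γ) (b : B) :
    L.d Ω X Y Z b = 0 := by
  have hsm := fun X Y => L.contMDiff_deriv X (ha Y)
  -- The terms of d(da) without derivatives cancel by the Jacobi identity. The second derivatives
  -- cancel because ρ is a morphism (`deriv_bracket`), and the mixed terms cancel in pairs.
  have jac : a b ((L.bracket (L.bracket X Y) Z).1 b) - a b ((L.bracket (L.bracket X Z) Y).1 b) +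
      a b ((L.bracket (L.bracket Y Z) X).1 b) = 0 := by
    have h := L.jacobi X Y Z
    rw [L.bracket_swap Z X, map_neg, L.bracket_swap X (L.bracket Y Z),
      L.bracket_swap Z, L.bracket_swap Y (L.bracket X Z)] at h
    have h' := congrArg (fun S : Γ => a b (S.1 b)) h
    simp only [Submodule.coe_add, Submodule.coe_neg, Pi.add_apply, Pi.neg_apply, map_add, map_neg,
      Submodule.coe_zero, Pi.zero_apply, map_zero] at h'
    linarith
  simp only [d, hΩ, dOneForm_apply]
  have expand : ∀ X Y Z : Γ, L.deriv X (L.deriv Y (fun b => a b (Z.1 b)) -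
      L.deriv Z (fun b => a b (Y.1 b)) - fun b => a b ((L.bracket Y Z).1 b)) =
      L.deriv X (L.deriv Y fun b => a b (Z.1 b)) - L.deriv X (L.deriv Z fun b => a b (Y.1 b)) -
        L.deriv X fun b => a b ((L.bracket Y Z).1 b) := by
    intro X Y Z
    rw [← L.deriv_sub X (hsm Y Z) (hsm Z Y)]
    exact L.deriv_sub X ((hsm Y Z).sub (hsm Z Y)) (ha _)
  rw [expand, expand, expand,
    L.deriv_bracket X Y (ha Z), L.deriv_bracket X Z (ha Y), L.deriv_bracket Y Z (ha X)]
  simp only [Pi.sub_apply]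
  linarith

end LieAlgebroid

/-! ## Cut-off frames of smooth vector bundles -/

section BundleFrames

/-- A function is smooth where its product with a smooth function is smooth and the latter does not
vanish. -/
theorem ContMDiffAt.of_mul {EP : Type*} [NormedAddCommGroup EP] [NormedSpace ℝ EP]
    {HP : Type*} [TopologicalSpace HP] {J : ModelWithCorners ℝ EP HP} {P : Type*}
    [TopologicalSpace P] [ChartedSpace HP P] {χ g : P → ℝ} {p : P}
    (hχ : ContMDiffAt J 𝓘(ℝ, ℝ) ∞ χ p) (h : ContMDiffAt J 𝓘(ℝ, ℝ) ∞ (fun q => χ q * g q) p)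
    (hp : χ p ≠ 0) : ContMDiffAt J 𝓘(ℝ, ℝ) ∞ g p := by
  have hinv : ContMDiffAt J 𝓘(ℝ, ℝ) ∞ (fun q => (χ q)⁻¹) p :=
    ContMDiffAt.comp p (g := fun x : ℝ => x⁻¹) ((contDiffAt_inv ℝ hp).contMDiffAt) hχ
  refine (hinv.mul h).congr_of_eventuallyEq ?_
  filter_upwards [hχ.continuousAt.eventually_ne hp] with q hq
  simp [hq]

variable {EM : Type*} [NormedAddCommGroup EM] [NormedSpace ℝ EM] {HM : Type*} [TopologicalSpace HM]
  {I : ModelWithCorners ℝ EM HM} {M : Type*} [TopologicalSpace M] [ChartedSpace HM M]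
  {F : Type*} [NormedAddCommGroup F] [NormedSpace ℝ F]
  {A : M → Type*} [TopologicalSpace (TotalSpace F A)] [∀ x, TopologicalSpace (A x)]
  [∀ x, AddCommGroup (A x)] [∀ x, Module ℝ (A x)]
  [FiberBundle F A] [VectorBundle ℝ F A]

theorem exists_smooth_cutoff [FiniteDimensional ℝ EM] [IsManifold I ∞ M] [T2Space M] {x₀ : M}
    {U : Set M} (hU : U ∈ 𝓝 x₀) :
    ∃ χ : M → ℝ, ContMDiff I 𝓘(ℝ, ℝ) ∞ χ ∧ χ x₀ = 1 ∧ tsupport χ ⊆ U := by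
  obtain ⟨f, -, hf⟩ := (SmoothBumpFunction.nhds_basis_tsupport (I := I) x₀).mem_iff.1 hU
  exact ⟨f, f.contMDiff, f.eq_one, hf⟩

section Along

variable {EP : Type*} [NormedAddCommGroup EP] [NormedSpace ℝ EP]
  {HP : Type*} [TopologicalSpace HP] {J : ModelWithCorners ℝ EP HP} {P : Type*}
  [TopologicalSpace P] [ChartedSpace HP P] {τ : P → M}
  (t : Trivialization F (TotalSpace.proj : TotalSpace F A → M)) [MemTrivializationAtlas t]

variable [IsManifold I ∞ M] [ContMDiffVectorBundle ∞ F A I]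

omit [IsManifold I ∞ M] in
/-- A smooth function to the model fibre, cut off inside the domain of a trivialization, is a
smooth section. -/
theorem contMDiff_cutoff_symm (hτ : ContMDiff J I ∞ τ) {χ : P → ℝ}
    (hχ : ContMDiff J 𝓘(ℝ, ℝ) ∞ χ) (hs : tsupport χ ⊆ τ ⁻¹' t.baseSet) {u : P → F}
    (hu : ContMDiffOn J 𝓘(ℝ, F) ∞ u (τ ⁻¹' t.baseSet)) :
    ContMDiff J (I.prod 𝓘(ℝ, F)) ∞
      (fun p => (⟨τ p, χ p • t.symm (τ p) (u p)⟩ : TotalSpace F A)) := by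
  intro p
  have hopen : IsOpen (τ ⁻¹' t.baseSet) := t.open_baseSet.preimage hτ.continuous
  by_cases hp : τ p ∈ t.baseSet
  · refine (t.contMDiffAt_iff (t.mem_source.2 (by exact hp))).2 ⟨hτ p, ?_⟩
    refine ((hχ p).smul (hu.contMDiffAt (hopen.mem_nhds hp))).congr_of_eventuallyEq ?_
    filter_upwards [hopen.mem_nhds hp] with q hq
    replace hq : τ q ∈ t.baseSet := hq
    rw [(t.linear ℝ hq).map_smul, t.apply_mk_symm hq]
    rfl
  -- Outside the base set p is not in the closed support of χ, so the section is zero on a whole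
  -- neighbourhood of p.
  · have h0 : χ =ᶠ[𝓝 p] 0 := notMem_tsupport_iff_eventuallyEq.1 fun h => hp (hs h)
    refine (((contMDiff_zeroSection (IB := I) (F := F) (n := ∞) ℝ A).comp hτ) p).congr_of_eventuallyEq ?_
    filter_upwards [h0] with q hq
    simp [hq, zeroSection]

omit [IsManifold I ∞ M] in
/-- The coordinates of a smooth section, cut off inside the domain of a trivialization. -/
theorem contMDiff_cutoff_linearMapAt {χ : P → ℝ} (hτ : ContMDiff J I ∞ τ)
    (hχ : ContMDiff J 𝓘(ℝ, ℝ) ∞ χ) (hs : tsupport χ ⊆ τ ⁻¹' t.baseSet) {s : ∀ p, A (τ p)}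
    (h : ContMDiff J (I.prod 𝓘(ℝ, F)) ∞ (fun p => (⟨τ p, s p⟩ : TotalSpace F A))) :
    ContMDiff J 𝓘(ℝ, F) ∞ (fun p => χ p • t.linearMapAt ℝ (τ p) (s p)) := by
  intro p
  have hopen : IsOpen (τ ⁻¹' t.baseSet) := t.open_baseSet.preimage hτ.continuous
  by_cases hp : τ p ∈ t.baseSet
  · have h2 := ((t.contMDiffAt_iff (t.mem_source.2 (by exact hp))).1 (h p)).2
    refine ((hχ p).smul h2).congr_of_eventuallyEq ?_
    filter_upwards [hopen.mem_nhds hp] with q hq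
    replace hq : τ q ∈ t.baseSet := hq
    rw [t.linearMapAt_apply, if_pos hq]
    rfl
  · have h0 : χ =ᶠ[𝓝 p] 0 := notMem_tsupport_iff_eventuallyEq.1 fun h => hp (hs h)
    refine (contMDiffAt_const (c := (0 : F))).congr_of_eventuallyEq ?_
    filter_upwards [h0] with q hq
    simp [hq]

end Along

variable [IsManifold I ∞ M] [ContMDiffVectorBundle ∞ F A I] [FiniteDimensional ℝ F]

/-- The cut-off frame given by a trivialization. -/
def trivializationFrame {x₀ : M} (t : Trivialization F (TotalSpace.proj : TotalSpace F A → M))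
    [MemTrivializationAtlas t] {χ : M → ℝ} (hχ : ContMDiff I 𝓘(ℝ, ℝ) ∞ χ) (h1 : χ x₀ = 1)
    (hs : tsupport χ ⊆ t.baseSet) : CutoffFrame I (smoothSections I F A) x₀ where
  ι := Fin (Module.finrank ℝ F)
  -- One factor extends the sections by zero beyond the base set, the other does this for the
  -- one-forms.
  χ x := χ x * χ x
  e i := ⟨fun x => χ x • t.symm x (Module.finBasis ℝ F i),
    contMDiff_cutoff_symm t contMDiff_id hχ hs contMDiffOn_const⟩
  α i x := χ x • ((Module.finBasis ℝ F).coord i ∘ₗ t.linearMapAt ℝ x)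
  χ_smooth := hχ.mul hχ
  χ_eq_one := by simp [h1]
  α_smooth i X := by
    have h := contMDiff_cutoff_linearMapAt t contMDiff_id hχ hs X.2
    have hc : ContDiff ℝ ∞ ((Module.finBasis ℝ F).coord i) :=
      ((Module.finBasis ℝ F).coord i).toContinuousLinearMap.contDiff
    exact (hc.contMDiff.comp h).congr fun x => by simp
  smul_eq x v := by
    by_cases hx : x ∈ t.baseSet
    · conv_lhs => rw [← t.symmₗ_linearMapAt (R := ℝ) hx v,
        ← (Module.finBasis ℝ F).sum_repr (t.linearMapAt ℝ x v), map_sum, Finset.smul_sum]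
      refine Finset.sum_congr rfl fun i _ => ?_
      rw [map_smul, t.symmₗ_apply hx]
      simp only [LinearMap.smul_apply, LinearMap.comp_apply, Module.Basis.coord_apply,
        smul_eq_mul, smul_smul]
      ring_nf
    · have : χ x = 0 := image_eq_zero_of_notMem_tsupport fun h => hx (hs h)
      simp [this]

-- The field `α_smooth` concerns sections over M only. The first component of a section of a
-- prolongation is a section along τ, generally not pulled back from M, and needs this version.
omit [IsManifold I ∞ M] in
theorem trivializationFrame_α_along {x₀ : M}
    (t : Trivialization F (TotalSpace.proj : TotalSpace F A → M))
    [MemTrivializationAtlas t] {χ : M → ℝ} (hχ : ContMDiff I 𝓘(ℝ, ℝ) ∞ χ) (h1 : χ x₀ = 1)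
    (hs : tsupport χ ⊆ t.baseSet) {EP : Type*} [NormedAddCommGroup EP] [NormedSpace ℝ EP]
    {HP : Type*} [TopologicalSpace HP] {J : ModelWithCorners ℝ EP HP} {P : Type*}
    [TopologicalSpace P] [ChartedSpace HP P] {τ : P → M} (hτ : ContMDiff J I ∞ τ) {s : ∀ p, A (τ p)}
    (h : ContMDiff J (I.prod 𝓘(ℝ, F)) ∞ (fun p => (⟨τ p, s p⟩ : TotalSpace F A)))
    (i : (trivializationFrame t hχ h1 hs).ι) :
    ContMDiff J 𝓘(ℝ, ℝ) ∞ (fun p => (trivializationFrame t hχ h1 hs).α i (τ p) (s p)) := by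
  have h := contMDiff_cutoff_linearMapAt t hτ (hχ.comp hτ)
    ((tsupport_comp_subset_preimage χ hτ.continuous).trans (Set.preimage_mono hs)) h
  have hc : ContDiff ℝ ∞ ((Module.finBasis ℝ F).coord i) :=
    ((Module.finBasis ℝ F).coord i).toContinuousLinearMap.contDiff
  exact (hc.contMDiff.comp h).congr fun x => by simp [trivializationFrame]

variable [FiniteDimensional ℝ EM] [T2Space M]

theorem hasCutoffFrames_smoothSections : HasCutoffFrames I (smoothSections I F A) where
  smul_mem f hf X hX := ContMDiff.smul_section hf hX
  frame x₀ := by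
    let t := trivializationAt F A x₀
    obtain ⟨χ, hχ, h1, hs⟩ := exists_smooth_cutoff (I := I)
      (t.open_baseSet.mem_nhds (mem_baseSet_trivializationAt F A x₀))
    exact ⟨trivializationFrame t hχ h1 hs⟩

section Along

variable {EP : Type*} [NormedAddCommGroup EP] [NormedSpace ℝ EP]
  {HP : Type*} [TopologicalSpace HP] {J : ModelWithCorners ℝ EP HP} {P : Type*}
  [TopologicalSpace P] [ChartedSpace HP P] {τ : P → M}

theorem exists_frame_along (hτ : ContMDiff J I ∞ τ) (x₀ : M) :
    ∃ φ : CutoffFrame I (smoothSections I F A) x₀, ∀ i (s : ∀ p, A (τ p)),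
      ContMDiff J (I.prod 𝓘(ℝ, F)) ∞ (fun p => (⟨τ p, s p⟩ : TotalSpace F A)) →
      ContMDiff J 𝓘(ℝ, ℝ) ∞ (fun p => φ.α i (τ p) (s p)) := by
  let t := trivializationAt F A x₀
  obtain ⟨χ, hχ, h1, hs⟩ := exists_smooth_cutoff (I := I)
    (t.open_baseSet.mem_nhds (mem_baseSet_trivializationAt F A x₀))
  exact ⟨trivializationFrame t hχ h1 hs, fun i s h => trivializationFrame_α_along t hχ h1 hs hτ h i⟩

/-- A smooth one-form is smooth on sections along a map. -/
theorem IsSmoothOneForm.contMDiff_along {a : ∀ x, A x →ₗ[ℝ] ℝ}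
    (ha : IsSmoothOneForm I (smoothSections I F A) a) (hτ : ContMDiff J I ∞ τ) {s : ∀ p, A (τ p)}
    (h : ContMDiff J (I.prod 𝓘(ℝ, F)) ∞ (fun p => (⟨τ p, s p⟩ : TotalSpace F A))) :
    ContMDiff J 𝓘(ℝ, ℝ) ∞ (fun p => a (τ p) (s p)) := by
  intro p₀
  obtain ⟨φ, hφ⟩ := exists_frame_along (A := A) (F := F) hτ (τ p₀)
  -- After multiplication by χ ∘ τ, which is 1 at p₀, the function expands in the frame into
  -- products of coefficients along τ and functions pulled back from M.
  refine ContMDiffAt.of_mul ((φ.χ_smooth.comp hτ) p₀) ?_ (by simp [φ.χ_eq_one])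
  have : (fun p => (φ.χ ∘ τ) p * a (τ p) (s p)) =
      fun p => ∑ i, φ.α i (τ p) (s p) * a (τ p) ((φ.e i).1 (τ p)) := by
    ext p
    have := congrArg (a (τ p)) (φ.smul_eq (τ p) (s p))
    simpa using this
  rw [this]
  exact (contMDiff_finsetSum fun i _ => (hφ i s h).mul ((ha (φ.e i)).comp hτ)) p₀

/-- A two-form is smooth on sections along a map. -/
theorem TwoForm.contMDiff_along (Ω : TwoForm I (smoothSections I F A)) (hτ : ContMDiff J I ∞ τ)
    {s s' : ∀ p, A (τ p)}
    (h : ContMDiff J (I.prod 𝓘(ℝ, F)) ∞ (fun p => (⟨τ p, s p⟩ : TotalSpace F A)))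
    (h' : ContMDiff J (I.prod 𝓘(ℝ, F)) ∞ (fun p => (⟨τ p, s' p⟩ : TotalSpace F A))) :
    ContMDiff J 𝓘(ℝ, ℝ) ∞ (fun p => Ω.toFun (τ p) (s p) (s' p)) := by
  intro p₀
  obtain ⟨φ, hφ⟩ := exists_frame_along (A := A) (F := F) hτ (τ p₀)
  refine ContMDiffAt.of_mul ((φ.χ_smooth.comp hτ) p₀) ?_ (by simp [φ.χ_eq_one])
  have : (fun p => (φ.χ ∘ τ) p * Ω.toFun (τ p) (s p) (s' p)) =
      fun p => ∑ i, φ.α i (τ p) (s p) * Ω.toFun (τ p) ((φ.e i).1 (τ p)) (s' p) := by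
    ext p
    have := congrArg (fun v => Ω.toFun (τ p) v (s' p)) (φ.smul_eq (τ p) (s p))
    simpa using this
  rw [this]
  refine (contMDiff_finsetSum fun i _ => (hφ i s h).mul ?_) p₀
  -- Only the first argument is expanded; with a frame section inserted there, Ω is a one-form in
  -- the second.
  exact IsSmoothOneForm.contMDiff_along (a := fun x => Ω.toFun x ((φ.e i).1 x))
    (fun X => Ω.smooth (φ.e i) X) hτ h'

/-- A section along a map is smooth if all smooth one-forms are smooth on it. -/
theorem contMDiff_along_of_oneForms (hτ : ContMDiff J I ∞ τ) {s : ∀ p, A (τ p)}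
    (h : ∀ a : ∀ x, A x →ₗ[ℝ] ℝ, IsSmoothOneForm I (smoothSections I F A) a →
      ContMDiff J 𝓘(ℝ, ℝ) ∞ (fun p => a (τ p) (s p))) :
    ContMDiff J (I.prod 𝓘(ℝ, F)) ∞ (fun p => (⟨τ p, s p⟩ : TotalSpace F A)) := by
  intro p₀
  let t := trivializationAt F A (τ p₀)
  obtain ⟨χ, hχ, h1, hs⟩ := exists_smooth_cutoff (I := I)
    (t.open_baseSet.mem_nhds (mem_baseSet_trivializationAt F A (τ p₀)))
  have hp₀ : τ p₀ ∈ t.baseSet := mem_baseSet_trivializationAt F A (τ p₀)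
  refine (t.contMDiffAt_iff (t.mem_source.2 hp₀)).2 ⟨hτ p₀, ?_⟩
  let bF := Module.finBasis ℝ F
  have hcoord : ∀ i, ContMDiffAt J 𝓘(ℝ, ℝ) ∞
      (fun p => bF.coord i (t.linearMapAt ℝ (τ p) (s p))) p₀ := by
    intro i
    refine ContMDiffAt.of_mul ((hχ.comp hτ) p₀) ?_ (by simp [h1])
    -- The coordinate multiplied by χ is a one-form of the frame, hence smooth by hypothesis; near
    -- p₀ the factor χ can be divided out.
    exact (h _ ((trivializationFrame t hχ h1 hs).α_smooth i)) p₀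
  have hsum : ContMDiffAt J 𝓘(ℝ, F) ∞
      (fun p => ∑ i, bF.coord i (t.linearMapAt ℝ (τ p) (s p)) • bF i) p₀ :=
    contMDiffAt_finsetSum fun i _ => (hcoord i).smul contMDiffAt_const
  refine hsum.congr_of_eventuallyEq ?_
  filter_upwards [(t.open_baseSet.preimage hτ.continuous).mem_nhds hp₀] with p hp
  replace hp : τ p ∈ t.baseSet := hp
  rw [t.linearMapAt_apply, if_pos hp]
  exact (bF.sum_repr _).symm

end Along

end BundleFrames

/-! ## Tangent vectors of the total space of a vector bundle -/

section TotalSpaceTangent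

variable {EM : Type*} [NormedAddCommGroup EM] [NormedSpace ℝ EM] {HM : Type*} [TopologicalSpace HM]
  {I : ModelWithCorners ℝ EM HM} {M : Type*} [TopologicalSpace M] [ChartedSpace HM M]
  [IsManifold I ∞ M]
  {G : Type*} [NormedAddCommGroup G] [NormedSpace ℝ G]
  {W : M → Type*} [TopologicalSpace (TotalSpace G W)] [∀ x, TopologicalSpace (W x)]
  [∀ x, AddCommGroup (W x)] [∀ x, Module ℝ (W x)]
  [FiberBundle G W] [VectorBundle ℝ G W] [ContMDiffVectorBundle ∞ G W I]

variable (I) in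
/-- The trivialization of the tangent bundle of the total space around a point. -/
def totalTangentTriv (p₀ : TotalSpace G W) :=
  trivializationAt (EM × G) (TangentSpace (I.prod 𝓘(ℝ, G)) : TotalSpace G W → Type _) p₀

variable (I) in
/-- The trivialization of the tangent bundle of the base around a point. -/
def baseTangentTriv (x₀ : M) := trivializationAt EM (TangentSpace I : M → Type _) x₀

instance (p₀ : TotalSpace G W) : MemTrivializationAtlas (totalTangentTriv I p₀) :=
  inferInstanceAs (MemTrivializationAtlas (trivializationAt _ _ _))

instance (x₀ : M) : MemTrivializationAtlas (baseTangentTriv I x₀) :=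
  inferInstanceAs (MemTrivializationAtlas (trivializationAt _ _ _))

theorem mem_baseTangentTriv_baseSet {x₀ x : M} :
    x ∈ (baseTangentTriv I x₀).baseSet ↔ x ∈ (chartAt HM x₀).source := by
  rw [baseTangentTriv, TangentBundle.trivializationAt_baseSet]

theorem mem_totalTangentTriv_baseSet {p₀ p : TotalSpace G W} :
    p ∈ (totalTangentTriv I p₀).baseSet ↔
      p.proj ∈ (trivializationAt G W p₀.proj).baseSet ∩ (chartAt HM p₀.proj).source := by
  rw [totalTangentTriv, TangentBundle.trivializationAt_baseSet, FiberBundle.chartedSpace_chartAt]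
  simp only [mfld_simps, Trivialization.mem_source]
  constructor
  · rintro ⟨h, h'⟩
    exact ⟨h, by simpa [h] using h'⟩
  · rintro ⟨h, h'⟩
    exact ⟨h, by simpa [h] using h'⟩

set_option linter.unusedSectionVars false in
theorem extChartAt_totalSpace_apply {p₀ p : TotalSpace G W}
    (hp : p.proj ∈ (trivializationAt G W p₀.proj).baseSet) :
    extChartAt (I.prod 𝓘(ℝ, G)) p₀ p =
      (extChartAt I p₀.proj p.proj, (trivializationAt G W p₀.proj p).2) := by
  rw [FiberBundle.extChartAt]
  simp [hp]

theorem totalTangentTriv_linearMapAt {p₀ p : TotalSpace G W}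
    (hp : p ∈ (totalTangentTriv I p₀).baseSet) (v : TangentSpace (I.prod 𝓘(ℝ, G)) p) :
    (totalTangentTriv I p₀).linearMapAt ℝ p v =
      mfderiv (I.prod 𝓘(ℝ, G)) 𝓘(ℝ, EM × G) (extChartAt (I.prod 𝓘(ℝ, G)) p₀) p v := by
  have h := TangentBundle.continuousLinearMapAt_trivializationAt (I := I.prod 𝓘(ℝ, G))
    (x₀ := p₀) (x := p) (by rwa [totalTangentTriv, TangentBundle.trivializationAt_baseSet] at hp)
  exact congrArg (fun L => L v) h

theorem baseTangentTriv_linearMapAt {x₀ x : M}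
    (hx : x ∈ (chartAt HM x₀).source) (v : TangentSpace I x) :
    (baseTangentTriv I x₀).linearMapAt ℝ x v = mfderiv I 𝓘(ℝ, EM) (extChartAt I x₀) x v :=
  congrArg (fun L => L v) (TangentBundle.continuousLinearMapAt_trivializationAt (I := I) hx)

/-- In bundle charts the differential of the projection is the first projection. -/
theorem baseTangentTriv_mfderiv_proj {p₀ p : TotalSpace G W}
    (hp : p ∈ (totalTangentTriv I p₀).baseSet) (v : TangentSpace (I.prod 𝓘(ℝ, G)) p) :
    (baseTangentTriv I p₀.proj).linearMapAt ℝ p.proj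
      (mfderiv (I.prod 𝓘(ℝ, G)) I (TotalSpace.proj : TotalSpace G W → M) p v) =
      ((totalTangentTriv I p₀).linearMapAt ℝ p v).1 := by
  have hp' := mem_totalTangentTriv_baseSet.1 hp
  rw [baseTangentTriv_linearMapAt hp'.2, totalTangentTriv_linearMapAt hp]
  have hproj : MDifferentiableAt (I.prod 𝓘(ℝ, G)) I (TotalSpace.proj : TotalSpace G W → M) p :=
    mdifferentiable_proj W p
  have hM : MDifferentiableAt I 𝓘(ℝ, EM) (extChartAt I p₀.proj) p.proj :=
    mdifferentiableAt_extChartAt hp'.2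
  have hps : p ∈ (chartAt (ModelProd HM G) p₀).source := by
    rwa [totalTangentTriv, TangentBundle.trivializationAt_baseSet] at hp
  have hP : MDifferentiableAt (I.prod 𝓘(ℝ, G)) 𝓘(ℝ, EM × G)
      (extChartAt (I.prod 𝓘(ℝ, G)) p₀) p := mdifferentiableAt_extChartAt hps
  have hfst : MDifferentiableAt 𝓘(ℝ, EM × G) 𝓘(ℝ, EM) (Prod.fst : EM × G → EM)
      (extChartAt (I.prod 𝓘(ℝ, G)) p₀ p) := differentiable_fst.mdifferentiable _
  -- In a bundle chart the projection is literally `Prod.fst`; the claim is the derivative of this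
  -- identity of germs.
  have heq : (extChartAt I p₀.proj ∘ (TotalSpace.proj : TotalSpace G W → M)) =ᶠ[𝓝 p]
      (Prod.fst ∘ extChartAt (I.prod 𝓘(ℝ, G)) p₀) := by
    filter_upwards [(totalTangentTriv I p₀).open_baseSet.mem_nhds hp] with q hq
    exact (congrArg Prod.fst
      (extChartAt_totalSpace_apply (mem_totalTangentTriv_baseSet.1 hq).1)).symm
  have h := heq.mfderiv_eq (I := I.prod 𝓘(ℝ, G)) (I' := 𝓘(ℝ, EM))
  rw [mfderiv_comp p hM hproj, mfderiv_comp p hfst hP] at h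
  have hd : mfderiv 𝓘(ℝ, EM × G) 𝓘(ℝ, EM) (Prod.fst : EM × G → EM)
      (extChartAt (I.prod 𝓘(ℝ, G)) p₀ p) = ContinuousLinearMap.fst ℝ EM G := by
    rw [mfderiv_eq_fderiv]
    exact fderiv_fst
  rw [hd] at h
  exact congrArg (fun L => L v) h

theorem Bundle.Trivialization.linearMapAt_symm_apply
    (t : Trivialization G (TotalSpace.proj : TotalSpace G W → M)) [MemTrivializationAtlas t]
    {x : M} (hx : x ∈ t.baseSet) (u : G) : t.linearMapAt ℝ x (t.symm x u) = u := by
  rw [← t.symmₗ_apply (R := ℝ) hx, t.linearMapAt_symmₗ hx]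

theorem Bundle.Trivialization.symm_linearMapAt_apply
    (t : Trivialization G (TotalSpace.proj : TotalSpace G W → M)) [MemTrivializationAtlas t]
    {x : M} (hx : x ∈ t.baseSet) (w : W x) : t.symm x (t.linearMapAt ℝ x w) = w := by
  rw [← t.symmₗ_apply (R := ℝ) hx, t.symmₗ_linearMapAt hx]

theorem Bundle.Trivialization.linearMapAt_injective
    (t : Trivialization G (TotalSpace.proj : TotalSpace G W → M)) [MemTrivializationAtlas t]
    {x : M} (hx : x ∈ t.baseSet) : Function.Injective (t.linearMapAt ℝ x) :=
  Function.LeftInverse.injective (g := t.symm x) (t.symm_linearMapAt_apply hx)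

theorem self_mem_totalTangentTriv (p : TotalSpace G W) : p ∈ (totalTangentTriv I p).baseSet :=
  mem_baseSet_trivializationAt _ _ p

variable (I) in
/-- The vertical tangent vector at `p` determined by an element of the fibre through `p`. -/
def verticalLift (p : TotalSpace G W) (w : W p.proj) :
    TangentSpace (I.prod 𝓘(ℝ, G)) p :=
  (totalTangentTriv I p).symm p (0, (trivializationAt G W p.proj).linearMapAt ℝ p.proj w)

/-- A tangent vector is vertical if its first component in a bundle chart vanishes. -/
theorem mfderiv_proj_eq_zero_iff {p₀ p : TotalSpace G W} (hp : p ∈ (totalTangentTriv I p₀).baseSet)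
    (v : TangentSpace (I.prod 𝓘(ℝ, G)) p) :
    mfderiv (I.prod 𝓘(ℝ, G)) I (TotalSpace.proj : TotalSpace G W → M) p v = 0 ↔
      ((totalTangentTriv I p₀).linearMapAt ℝ p v).1 = 0 := by
  rw [← baseTangentTriv_mfderiv_proj hp]
  refine ⟨fun h => by rw [h, map_zero], fun h => ?_⟩
  exact (baseTangentTriv I p₀.proj).linearMapAt_injective
    (mem_baseTangentTriv_baseSet.2 (mem_totalTangentTriv_baseSet.1 hp).2) (h.trans (map_zero _).symm)

theorem mfderiv_proj_verticalLift (p : TotalSpace G W) (w : W p.proj) :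
    mfderiv (I.prod 𝓘(ℝ, G)) I (TotalSpace.proj : TotalSpace G W → M) p
      (verticalLift I p w) = 0 := by
  rw [mfderiv_proj_eq_zero_iff (self_mem_totalTangentTriv p), verticalLift,
    (totalTangentTriv I p).linearMapAt_symm_apply (self_mem_totalTangentTriv p)]

theorem exists_verticalLift_eq {p : TotalSpace G W} {v : TangentSpace (I.prod 𝓘(ℝ, G)) p}
    (hv : mfderiv (I.prod 𝓘(ℝ, G)) I (TotalSpace.proj : TotalSpace G W → M) p v = 0) :
    ∃ w, v = verticalLift I p w := by
  have hp := self_mem_totalTangentTriv (I := I) p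
  have hW : p.proj ∈ (trivializationAt G W p.proj).baseSet := mem_baseSet_trivializationAt G W _
  refine ⟨(trivializationAt G W p.proj).symm p.proj ((totalTangentTriv I p).linearMapAt ℝ p v).2, ?_⟩
  rw [verticalLift, Trivialization.linearMapAt_symm_apply _ hW,
    ← (mfderiv_proj_eq_zero_iff hp v).1 hv, Prod.mk.eta, Trivialization.symm_linearMapAt_apply _ hp]

theorem verticalLift_zero (p : TotalSpace G W) : verticalLift I p (0 : W p.proj) = 0 := by
  have hp := self_mem_totalTangentTriv (I := I) p
  apply Trivialization.linearMapAt_injective _ hp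
  rw [verticalLift, Trivialization.linearMapAt_symm_apply _ hp, map_zero, map_zero]
  rfl

/-- The derivative of a fibrewise linear function along a vertical vector. -/
theorem mvfderiv_verticalLift {f : TotalSpace G W → ℝ}
    (hf : ContMDiff (I.prod 𝓘(ℝ, G)) 𝓘(ℝ, ℝ) ∞ f) {p : TotalSpace G W} (w : W p.proj)
    (a : W p.proj →ₗ[ℝ] ℝ) (ha : ∀ w', f ⟨p.proj, w'⟩ = a w') :
    mvfderiv (I.prod 𝓘(ℝ, G)) f p (verticalLift I p w) = a w := by
  obtain ⟨x, y⟩ := p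
  dsimp only at w a ha
  -- The base point is rewritten as c(0) for the line c(s) = z + s • w in the fibre, so that no
  -- transport between tangent spaces is needed. The velocity of c at 0 is the vertical lift, and f
  -- is affine along c with slope a(w).
  obtain ⟨z, rfl⟩ : ∃ z, y = z + (0 : ℝ) • w := ⟨y, by simp⟩
  let t := trivializationAt G W x
  have hx : x ∈ t.baseSet := mem_baseSet_trivializationAt G W x
  let c : ℝ → TotalSpace G W := fun s => ⟨x, z + s • w⟩
  have htc : ∀ s, (t (c s)).2 = t.linearMapAt ℝ x z + s • t.linearMapAt ℝ x w := by
    intro s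
    rw [← map_smul, ← map_add, t.linearMapAt_apply, if_pos hx]
  have hc : MDifferentiableAt 𝓘(ℝ, ℝ) (I.prod 𝓘(ℝ, G)) c 0 := by
    have : ContMDiffAt 𝓘(ℝ, ℝ) (I.prod 𝓘(ℝ, G)) ∞ c 0 := by
      refine (t.contMDiffAt_iff (t.mem_source.2 hx)).2 ⟨contMDiffAt_const, ?_⟩
      simp_rw [htc]
      exact contMDiffAt_const.add (contMDiffAt_id.smul contMDiffAt_const)
    exact this.mdifferentiableAt (by simp)
  have hvel : mfderiv 𝓘(ℝ, ℝ) (I.prod 𝓘(ℝ, G)) c 0 (1 : ℝ) = verticalLift I (c 0) w := by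
    have hp := self_mem_totalTangentTriv (I := I) (c 0)
    apply Trivialization.linearMapAt_injective _ hp
    rw [verticalLift, Trivialization.linearMapAt_symm_apply _ hp, totalTangentTriv_linearMapAt hp]
    have hext : MDifferentiableAt (I.prod 𝓘(ℝ, G)) 𝓘(ℝ, EM × G)
        (extChartAt (I.prod 𝓘(ℝ, G)) (c 0)) (c 0) :=
      mdifferentiableAt_extChartAt (mem_chart_source _ _)
    have hcomp := mfderiv_comp (0 : ℝ) hext hc
    have heq : extChartAt (I.prod 𝓘(ℝ, G)) (c 0) ∘ c = fun s =>
        (extChartAt I x x, t.linearMapAt ℝ x z + s • t.linearMapAt ℝ x w) := by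
      ext1 s
      refine (extChartAt_totalSpace_apply (p₀ := c 0) (p := c s) hx).trans ?_
      exact Prod.ext rfl (htc s)
    have hder : HasFDerivAt (fun s : ℝ =>
        (extChartAt I x x, t.linearMapAt ℝ x z + s • t.linearMapAt ℝ x w))
        ((0 : ℝ →L[ℝ] EM).prod ((ContinuousLinearMap.id ℝ ℝ).smulRight
          (t.linearMapAt ℝ x w))) 0 :=
      (hasFDerivAt_const _ _).prodMk (((hasFDerivAt_id _).smul_const _).const_add _)
    rw [heq, hder.hasMFDerivAt.mfderiv] at hcomp
    refine (congrArg (fun L => L (1 : ℝ)) hcomp).symm.trans ?_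
    exact Prod.ext rfl (one_smul ℝ _)
  have hfc := mvfderiv_comp_apply (0 : ℝ) (hf.mdifferentiableAt_of_smooth (c 0)) hc (1 : ℝ)
  rw [hvel] at hfc
  refine hfc.symm.trans ?_
  have heq : f ∘ c = fun s => a z + s * a w := by
    ext s
    simp [c, ha]
  have hder : HasFDerivAt (fun s : ℝ => a z + s * a w)
      ((ContinuousLinearMap.id ℝ ℝ).smulRight (a w)) 0 :=
    ((hasFDerivAt_id (𝕜 := ℝ) (0 : ℝ)).smul_const (a w)).const_add _
  rw [heq, mvfderiv, hder.hasMFDerivAt.mfderiv]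
  exact one_smul ℝ (a w)

end TotalSpaceTangent

/-! ## Frames and rank -/

section Rank

variable {EB : Type*} [NormedAddCommGroup EB] [NormedSpace ℝ EB] {HB : Type*} [TopologicalSpace HB]
  {J : ModelWithCorners ℝ EB HB} {B : Type*} [TopologicalSpace B] [ChartedSpace HB B]
  {V : B → Type*} [∀ b, AddCommGroup (V b)] [∀ b, Module ℝ (V b)] {Γ : Submodule ℝ (∀ b, V b)}

/-- The one-forms of the frame are dual to its sections, up to the cut-off function. -/
def CutoffFrame.IsDual {b₀ : B} (φ : CutoffFrame J Γ b₀) [DecidableEq φ.ι] : Prop :=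
  ∀ i j b, φ.α i b ((φ.e j).1 b) = if i = j then φ.χ b else 0

-- On the open set where χ ≠ 0 duality makes the e_i independent, the frame identity makes them
-- span, and the smooth coefficients are χ⁻¹ α_i(X).
open Classical in
theorem isSmoothBundleOfRank_of_frames {r : ℕ}
    (h : ∀ b₀, ∃ φ : CutoffFrame J Γ b₀, φ.IsDual ∧ Fintype.card φ.ι = r) :
    IsSmoothBundleOfRank J Γ r := by
  intro b₀
  obtain ⟨φ, hd, hr⟩ := h b₀
  let ε : Fin r ≃ φ.ι := (Fintype.equivFinOfCardEq hr).symm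
  have hcont := φ.χ_smooth.continuous
  refine ⟨{b | φ.χ b ≠ 0}, isOpen_ne_fun hcont continuous_const, by simp [φ.χ_eq_one],
    fun i => φ.e (ε i), fun b hb => ⟨?_, ?_⟩, fun X => ?_⟩
  · rw [Fintype.linearIndependent_iff]
    intro g hg i
    have h1 := congrArg (φ.α (ε i) b) hg
    simp only [map_sum, map_smul, hd _ _ b, smul_eq_mul, map_zero, ε.injective.eq_iff] at h1
    simpa [show φ.χ b ≠ 0 from hb] using h1
  · rw [eq_top_iff]
    intro v _
    have h1 : v = (φ.χ b)⁻¹ • ∑ i, φ.α i b v • (φ.e i).1 b := by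
      rw [← φ.smul_eq, smul_smul, inv_mul_cancel₀ hb, one_smul]
    rw [h1]
    refine Submodule.smul_mem _ _ (Submodule.sum_mem _ fun i _ => Submodule.smul_mem _ _ ?_)
    exact Submodule.subset_span ⟨ε.symm i, by simp⟩
  · refine ⟨fun i b => (φ.χ b)⁻¹ * φ.α (ε i) b (X.1 b), fun i b hb => ?_, fun b hb => ?_⟩
    · have hinv : ContMDiffAt J 𝓘(ℝ, ℝ) ∞ (fun q => (φ.χ q)⁻¹) b :=
        ContMDiffAt.comp b (g := fun x : ℝ => x⁻¹) ((contDiffAt_inv ℝ hb).contMDiffAt)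
          (φ.χ_smooth b)
      exact (hinv.mul (φ.α_smooth (ε i) X b)).contMDiffWithinAt
    · have h1 : X.1 b = (φ.χ b)⁻¹ • ∑ i, φ.α i b (X.1 b) • (φ.e i).1 b := by
        rw [← φ.smul_eq, smul_smul, inv_mul_cancel₀ hb, one_smul]
      conv_lhs => rw [h1, Finset.smul_sum, ← ε.sum_comp]
      simp [smul_smul]

end Rank

/-! ## Frames of prolongations -/

section ProlongationSections

variable {EM : Type*} [NormedAddCommGroup EM] [NormedSpace ℝ EM] {HM : Type*} [TopologicalSpace HM]
  {I : ModelWithCorners ℝ EM HM} {M : Type*} [TopologicalSpace M] [ChartedSpace HM M]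
  [IsManifold I ∞ M]
  {F : Type*} [NormedAddCommGroup F] [NormedSpace ℝ F]
  {A : M → Type*} [TopologicalSpace (TotalSpace F A)] [∀ x, TopologicalSpace (A x)]
  [∀ x, AddCommGroup (A x)] [∀ x, Module ℝ (A x)]
  [FiberBundle F A] [VectorBundle ℝ F A] [ContMDiffVectorBundle ∞ F A I]
  {EP : Type*} [NormedAddCommGroup EP] [NormedSpace ℝ EP] {HP : Type*} [TopologicalSpace HP]
  {J : ModelWithCorners ℝ EP HP} {P : Type*} [TopologicalSpace P] [ChartedSpace HP P]
  [IsManifold J ∞ P]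
  {L : LieAlgebroid I (smoothSections I F A)} {τ : P → M} {hτ : ContMDiff J I ∞ τ}

theorem contMDiff_smul_along {f : P → ℝ} (hf : ContMDiff J 𝓘(ℝ, ℝ) ∞ f) {s : ∀ p, A (τ p)}
    (hs : ContMDiff J (I.prod 𝓘(ℝ, F)) ∞ (fun p => (⟨τ p, s p⟩ : TotalSpace F A))) :
    ContMDiff J (I.prod 𝓘(ℝ, F)) ∞ (fun p => (⟨τ p, f p • s p⟩ : TotalSpace F A)) := by
  intro p₀
  have hs' := contMDiffAt_totalSpace.1 (hs p₀)
  refine contMDiffAt_totalSpace.2 ⟨hs'.1, ((hf p₀).smul hs'.2).congr_of_eventuallyEq ?_⟩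
  have hb : ∀ᶠ p in 𝓝 p₀, τ p ∈ (trivializationAt F A (τ p₀)).baseSet :=
    hs'.1.continuousAt.eventually
      ((trivializationAt F A (τ p₀)).open_baseSet.mem_nhds (mem_baseSet_trivializationAt F A _))
  filter_upwards [hb] with p hp
  simp [((trivializationAt F A (τ p₀)).linear ℝ hp).map_smul]

theorem mem_prolongationFiber {p : P} {z : A (τ p) × TangentSpace J p} :
    z ∈ prolongationFiber J L τ p ↔ L.anchor (τ p) z.1 = mfderiv J I τ p z.2 :=
  LinearMap.mem_eqLocus

/-- The section of the prolongation with given components. -/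
def prolongationSection (hτ : ContMDiff J I ∞ τ) (s : ∀ p, A (τ p)) (X : ∀ p, TangentSpace J p)
    (hs : ContMDiff J (I.prod 𝓘(ℝ, F)) ∞ (fun p => (⟨τ p, s p⟩ : TotalSpace F A)))
    (hX : ContMDiff J J.tangent ∞ (fun p => (⟨p, X p⟩ : TangentBundle J P)))
    (h : ∀ p, L.anchor (τ p) (s p) = mfderiv J I τ p (X p)) : prolongationSections J L τ hτ :=
  ⟨fun p => ⟨(s p, X p), mem_prolongationFiber.2 (h p)⟩, hs, hX⟩

theorem prolongationSections_smul_mem (f : P → ℝ) (hf : ContMDiff J 𝓘(ℝ, ℝ) ∞ f)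
    (S : ∀ p, prolongationFiber J L τ p) (hS : S ∈ prolongationSections J L τ hτ) :
    (fun p => f p • S p) ∈ prolongationSections J L τ hτ :=
  ⟨contMDiff_smul_along hf hS.1, ContMDiff.smul_section hf hS.2⟩

end ProlongationSections

/-! ### Frames of horizontal and vertical sections in bundle charts -/

section ProlongationFrames

open Classical in
theorem trivializationFrame_isDual
    {EM : Type*} [NormedAddCommGroup EM] [NormedSpace ℝ EM] {HM : Type*} [TopologicalSpace HM]
    {I : ModelWithCorners ℝ EM HM} {M : Type*} [TopologicalSpace M] [ChartedSpace HM M]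
    [IsManifold I ∞ M]
    {F : Type*} [NormedAddCommGroup F] [NormedSpace ℝ F]
    {A : M → Type*} [TopologicalSpace (TotalSpace F A)] [∀ x, TopologicalSpace (A x)]
    [∀ x, AddCommGroup (A x)] [∀ x, Module ℝ (A x)]
    [FiberBundle F A] [VectorBundle ℝ F A] [ContMDiffVectorBundle ∞ F A I] [FiniteDimensional ℝ F]
    {x₀ : M} (t : Trivialization F (TotalSpace.proj : TotalSpace F A → M))
    [MemTrivializationAtlas t] {χ : M → ℝ} (hχ : ContMDiff I 𝓘(ℝ, ℝ) ∞ χ) (h1 : χ x₀ = 1)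
    (hs : tsupport χ ⊆ t.baseSet) : (trivializationFrame t hχ h1 hs).IsDual := by
  intro (i : Fin (Module.finrank ℝ F)) (j : Fin (Module.finrank ℝ F)) x
  have key : χ x * (Module.finBasis ℝ F).repr
    (t.linearMapAt ℝ x (χ x • t.symm x (Module.finBasis ℝ F j))) i = if i = j then χ x * χ x else 0 := by
    by_cases hx : x ∈ t.baseSet
    · rw [map_smul, t.linearMapAt_symm_apply hx, map_smul, Finsupp.smul_apply,
        Module.Basis.repr_self_apply]
      by_cases h : i = j
      · simp [h]
      · simp [h, Ne.symm h]
    · have : χ x = 0 := image_eq_zero_of_notMem_tsupport fun h => hx (hs h)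
      simp [this]
  refine key.trans ?_
  by_cases h : i = j
  · rw [if_pos h]; exact (if_pos h).symm
  · rw [if_neg h]; exact (if_neg h).symm

variable {EM : Type*} [NormedAddCommGroup EM] [NormedSpace ℝ EM] {HM : Type*} [TopologicalSpace HM]
  {I : ModelWithCorners ℝ EM HM} {M : Type*} [TopologicalSpace M] [ChartedSpace HM M]
  [IsManifold I ∞ M]
  {F : Type*} [NormedAddCommGroup F] [NormedSpace ℝ F]
  {A : M → Type*} [TopologicalSpace (TotalSpace F A)] [∀ x, TopologicalSpace (A x)]
  [∀ x, AddCommGroup (A x)] [∀ x, Module ℝ (A x)]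
  [FiberBundle F A] [VectorBundle ℝ F A] [ContMDiffVectorBundle ∞ F A I]
  {G : Type*} [NormedAddCommGroup G] [NormedSpace ℝ G]
  {W : M → Type*} [TopologicalSpace (TotalSpace G W)] [∀ x, TopologicalSpace (W x)]
  [∀ x, AddCommGroup (W x)] [∀ x, Module ℝ (W x)]
  [FiberBundle G W] [VectorBundle ℝ G W] [ContMDiffVectorBundle ∞ G W I]
  (L : LieAlgebroid I (smoothSections I F A))

variable (I G W) in
/-- A smooth function on the base, equal to one at a point and supported in the domain of the bundle
chart around it. -/
structure ChartCutoff (x₀ : M) where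
  /-- the function -/
  χ : M → ℝ
  smooth : ContMDiff I 𝓘(ℝ, ℝ) ∞ χ
  eq_one : χ x₀ = 1
  tsupport_subset : tsupport χ ⊆ (trivializationAt G W x₀).baseSet ∩ (chartAt HM x₀).source

namespace ChartCutoff

variable {p₀ : TotalSpace G W} (c : ChartCutoff I G W p₀.proj)

theorem smooth_comp_proj : ContMDiff (I.prod 𝓘(ℝ, G)) 𝓘(ℝ, ℝ) ∞
    (fun p : TotalSpace G W => c.χ p.proj) :=
  c.smooth.comp (contMDiff_proj W)

theorem tsupport_comp_proj_subset : tsupport (fun p : TotalSpace G W => c.χ p.proj) ⊆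
    id ⁻¹' (totalTangentTriv I p₀).baseSet := by
  intro p hp
  have h := c.tsupport_subset (tsupport_comp_subset_preimage c.χ (FiberBundle.continuous_proj G W) hp)
  exact (mem_totalTangentTriv_baseSet (I := I) (p₀ := p₀)).2 h

theorem eq_zero_of_notMem {p : TotalSpace G W} (hp : p ∉ (totalTangentTriv I p₀).baseSet) :
    c.χ p.proj = 0 :=
  image_eq_zero_of_notMem_tsupport (f := fun p : TotalSpace G W => c.χ p.proj)
    fun h => hp (c.tsupport_comp_proj_subset h)

/-- A vector field with given components in a bundle chart, cut off. -/
def field (u : TotalSpace G W → EM × G) (p : TotalSpace G W) : TangentSpace (I.prod 𝓘(ℝ, G)) p :=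
  c.χ p.proj • (totalTangentTriv I p₀).symm p (u p)

theorem contMDiff_field {u : TotalSpace G W → EM × G}
    (hu : ContMDiffOn (I.prod 𝓘(ℝ, G)) 𝓘(ℝ, EM × G) ∞ u (totalTangentTriv I p₀).baseSet) :
    ContMDiff (I.prod 𝓘(ℝ, G)) (I.prod 𝓘(ℝ, G)).tangent ∞
      (fun p => (⟨p, c.field u p⟩ : TangentBundle (I.prod 𝓘(ℝ, G)) (TotalSpace G W))) :=
  contMDiff_cutoff_symm (totalTangentTriv I p₀) contMDiff_id c.smooth_comp_proj
    c.tsupport_comp_proj_subset hu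

theorem linearMapAt_field {u : TotalSpace G W → EM × G} {p : TotalSpace G W}
    (hp : p ∈ (totalTangentTriv I p₀).baseSet) :
    (totalTangentTriv I p₀).linearMapAt ℝ p (c.field u p) = c.χ p.proj • u p := by
  rw [field, map_smul, (totalTangentTriv I p₀).linearMapAt_symm_apply hp]

/-- The horizontal lift of a section, cut off. -/
def horizontal (σ : smoothSections I F A) :
    prolongationSections (I.prod 𝓘(ℝ, G)) L (TotalSpace.proj : TotalSpace G W → M)
      (contMDiff_proj W) :=
  -- In the bundle chart the field has base part ρ(σ) and fibre part 0. Both components carry the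
  -- same factor χ, as the linear condition defining the fibre demands.
  prolongationSection (contMDiff_proj W) (fun p => c.χ p.proj • σ.1 p.proj)
    (c.field fun p =>
      ((baseTangentTriv I p₀.proj).linearMapAt ℝ p.proj (L.anchor p.proj (σ.1 p.proj)), 0))
    (contMDiff_smul_along c.smooth_comp_proj (σ.2.comp (contMDiff_proj W)))
    (by
      refine c.contMDiff_field (ContMDiffOn.prodMk_space (fun p hp => ?_) contMDiffOn_const)
      have hx := (mem_baseTangentTriv_baseSet (I := I)).2 (mem_totalTangentTriv_baseSet.1 hp).2
      have h := ((baseTangentTriv I p₀.proj).contMDiffAt_section_iff hx).1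
        (L.anchor_smooth σ p.proj)
      have h2 : ContMDiffAt I 𝓘(ℝ, EM) ∞ (fun x => (baseTangentTriv I p₀.proj).linearMapAt ℝ x
          (L.anchor x (σ.1 x))) p.proj := by
        refine h.congr_of_eventuallyEq ?_
        filter_upwards [(baseTangentTriv I p₀.proj).open_baseSet.mem_nhds hx] with y hy
        rw [Trivialization.linearMapAt_apply, if_pos hy]
      exact (h2.comp p (contMDiff_proj W p)).contMDiffWithinAt)
    (by
      intro p
      by_cases hp : p ∈ (totalTangentTriv I p₀).baseSet
      · have hx := (mem_baseTangentTriv_baseSet (I := I)).2 (mem_totalTangentTriv_baseSet.1 hp).2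
        apply (baseTangentTriv I p₀.proj).linearMapAt_injective hx
        rw [baseTangentTriv_mfderiv_proj hp, c.linearMapAt_field hp, map_smul, map_smul]
        rfl
      · simp [field, c.eq_zero_of_notMem hp])

/-- A vertical section, cut off. -/
def vertical (u : G) :
    prolongationSections (I.prod 𝓘(ℝ, G)) L (TotalSpace.proj : TotalSpace G W → M)
      (contMDiff_proj W) :=
  prolongationSection (contMDiff_proj W) (fun _ => 0) (c.field fun _ => (0, u))
    ((contMDiff_zeroSection ℝ A).comp (contMDiff_proj W))
    (c.contMDiff_field contMDiffOn_const)
    (by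
      intro p
      rw [map_zero, eq_comm]
      by_cases hp : p ∈ (totalTangentTriv I p₀).baseSet
      · rw [mfderiv_proj_eq_zero_iff hp, c.linearMapAt_field hp]
        simp
      · simp [field, c.eq_zero_of_notMem hp])

variable [FiniteDimensional ℝ G]

/-- The cut-off frame of the prolongation given by a frame of `A` and a bundle chart. -/
def prolongationFrame (φ : CutoffFrame I (smoothSections I F A) p₀.proj)
    (hφ : ∀ i (s : ∀ p : TotalSpace G W, A p.proj), ContMDiff (I.prod 𝓘(ℝ, G)) (I.prod 𝓘(ℝ, F)) ∞
      (fun p => (⟨p.proj, s p⟩ : TotalSpace F A)) →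
      ContMDiff (I.prod 𝓘(ℝ, G)) 𝓘(ℝ, ℝ) ∞ (fun p => φ.α i p.proj (s p))) :
    CutoffFrame (I.prod 𝓘(ℝ, G)) (prolongationSections (I.prod 𝓘(ℝ, G)) L
      (TotalSpace.proj : TotalSpace G W → M) (contMDiff_proj W)) p₀ where
  ι := φ.ι ⊕ Fin (Module.finrank ℝ G)
  -- Every section and every one-form carries one factor `c.χ`. Expanding b in φ adds a factor
  -- `φ.χ`, which the vertical one-forms are given as well so that the two parts add up to the same
  -- multiple.
  χ p := φ.χ p.proj * c.χ p.proj * c.χ p.proj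
  e := Sum.elim (fun i => c.horizontal L (φ.e i)) fun k => c.vertical L (Module.finBasis ℝ G k)
  α := Sum.elim
    (fun i p => c.χ p.proj • (φ.α i p.proj ∘ₗ LinearMap.fst ℝ _ _ ∘ₗ Submodule.subtype _))
    fun k p => (φ.χ p.proj * c.χ p.proj) • ((Module.finBasis ℝ G).coord k ∘ₗ LinearMap.snd ℝ EM G ∘ₗ
      (totalTangentTriv I p₀).linearMapAt ℝ p ∘ₗ LinearMap.snd ℝ _ _ ∘ₗ Submodule.subtype _)
  χ_smooth := ((φ.χ_smooth.comp (contMDiff_proj W)).mul c.smooth_comp_proj).mul c.smooth_comp_proj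
  χ_eq_one := by simp [φ.χ_eq_one, c.eq_one]
  α_smooth := by
    rintro (i | k) X
    · exact c.smooth_comp_proj.mul (hφ i _ X.2.1)
    · have h := contMDiff_cutoff_linearMapAt (totalTangentTriv I p₀) contMDiff_id
        c.smooth_comp_proj c.tsupport_comp_proj_subset X.2.2
      have hc : ContDiff ℝ ∞ ((Module.finBasis ℝ G).coord k ∘ₗ LinearMap.snd ℝ EM G) :=
        (((Module.finBasis ℝ G).coord k).toContinuousLinearMap ∘L
          ContinuousLinearMap.snd ℝ EM G).contDiff
      refine ((φ.χ_smooth.comp (contMDiff_proj W)).mul (hc.contMDiff.comp h)).congr fun p => ?_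
      simp [mul_assoc]
  smul_eq p z := by
    obtain ⟨⟨b, v⟩, hz⟩ := z
    replace hz : L.anchor p.proj b = mfderiv (I.prod 𝓘(ℝ, G)) I _ p v := mem_prolongationFiber.1 hz
    have hb := φ.smul_eq p.proj b
    apply Subtype.ext
    rw [Fintype.sum_sum_type, Submodule.coe_add, Submodule.coe_sum, Submodule.coe_sum]
    apply Prod.ext
    · rw [Prod.fst_add, Prod.fst_sum, Prod.fst_sum]
      simp only [Sum.elim_inl, Sum.elim_inr]
      change (φ.χ p.proj * c.χ p.proj * c.χ p.proj) • b =
        ∑ i, (c.χ p.proj * φ.α i p.proj b) • c.χ p.proj • (φ.e i).1 p.proj + ∑ k, _ • (0 : A p.proj)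
      simp only [smul_zero, Finset.sum_const_zero, add_zero]
      calc (φ.χ p.proj * c.χ p.proj * c.χ p.proj) • b
          = (c.χ p.proj * c.χ p.proj) • φ.χ p.proj • b := by rw [smul_smul]; congr 1; ring
        _ = _ := by
          rw [hb, Finset.smul_sum]
          refine Finset.sum_congr rfl fun i _ => ?_
          simp only [smul_smul]
          congr 1; ring
    · rw [Prod.snd_add, Prod.snd_sum, Prod.snd_sum]
      simp only [Sum.elim_inl, Sum.elim_inr]
      change (φ.χ p.proj * c.χ p.proj * c.χ p.proj) • v =
        ∑ i, (c.χ p.proj * φ.α i p.proj b) • c.field (fun p =>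
          ((baseTangentTriv I p₀.proj).linearMapAt ℝ p.proj
            (L.anchor p.proj ((φ.e i).1 p.proj)), 0)) p +
        ∑ k, ((φ.χ p.proj * c.χ p.proj) * (Module.finBasis ℝ G).repr
          ((totalTangentTriv I p₀).linearMapAt ℝ p v).2 k) •
            c.field (fun _ => (0, Module.finBasis ℝ G k)) p
      by_cases hp : p ∈ (totalTangentTriv I p₀).baseSet
      · apply (totalTangentTriv I p₀).linearMapAt_injective hp
        simp only [map_add, map_sum, map_smul, c.linearMapAt_field hp]
        apply Prod.ext
        -- The base part of v equals ρ(b) by the fibre condition, so the expansion of b determines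
        -- it. Only the fibre part of v needs coordinates of its own.
        · have h1 := baseTangentTriv_mfderiv_proj hp v
          rw [← hz] at h1
          simp only [Prod.smul_fst, Prod.fst_add, Prod.fst_sum, smul_zero, Finset.sum_const_zero,
            add_zero, ← h1]
          have h2 := congrArg (fun y => (baseTangentTriv I p₀.proj).linearMapAt ℝ p.proj
            (L.anchor p.proj y)) hb
          simp only [map_smul, map_sum] at h2
          calc _ = (c.χ p.proj * c.χ p.proj) • φ.χ p.proj •
                (baseTangentTriv I p₀.proj).linearMapAt ℝ p.proj (L.anchor p.proj b) := by
                rw [smul_smul]; congr 1; ring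
            _ = _ := by
              rw [h2, Finset.smul_sum]
              refine Finset.sum_congr rfl fun i _ => ?_
              simp only [smul_smul]
              congr 1; ring
        · simp only [Prod.smul_snd, Prod.snd_add, Prod.snd_sum, smul_zero, Finset.sum_const_zero,
            zero_add]
          conv_lhs => rw [← (Module.finBasis ℝ G).sum_repr
            ((totalTangentTriv I p₀).linearMapAt ℝ p v).2, Finset.smul_sum]
          refine Finset.sum_congr rfl fun k _ => ?_
          simp only [smul_smul]
          congr 1; ring
      · simp [c.eq_zero_of_notMem hp]

/-- Mixed entries vanish because horizontal sections have no fibre part in the chart and vertical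
ones have no A-component. The diagonal blocks are the dualities of φ and of the basis of G. -/
theorem prolongationFrame_isDual (φ : CutoffFrame I (smoothSections I F A) p₀.proj)
    (hφ : ∀ i (s : ∀ p : TotalSpace G W, A p.proj), ContMDiff (I.prod 𝓘(ℝ, G)) (I.prod 𝓘(ℝ, F)) ∞
      (fun p => (⟨p.proj, s p⟩ : TotalSpace F A)) →
      ContMDiff (I.prod 𝓘(ℝ, G)) 𝓘(ℝ, ℝ) ∞ (fun p => φ.α i p.proj (s p)))
    [DecidableEq φ.ι] [DecidableEq (c.prolongationFrame L φ hφ).ι] (hd : φ.IsDual) :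
    (c.prolongationFrame L φ hφ).IsDual := by
  have hsnd : ∀ (u : TotalSpace G W → EM × G) p, c.χ p.proj •
      ((totalTangentTriv I p₀).linearMapAt ℝ p (c.field u p)).2 =
        (c.χ p.proj * c.χ p.proj) • (u p).2 := by
    intro u p
    by_cases hp : p ∈ (totalTangentTriv I p₀).baseSet
    · rw [c.linearMapAt_field hp, Prod.smul_snd, smul_smul]
    · simp [c.eq_zero_of_notMem hp]
  have hcoord : ∀ (u : TotalSpace G W → EM × G) p k, c.χ p.proj * (Module.finBasis ℝ G).coord k
      ((totalTangentTriv I p₀).linearMapAt ℝ p (c.field u p)).2 =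
        (c.χ p.proj * c.χ p.proj) * (Module.finBasis ℝ G).coord k (u p).2 := by
    intro u p k
    rw [← smul_eq_mul, ← map_smul, hsnd, map_smul, smul_eq_mul]
  rintro (i | k) (j | l) p
  · change c.χ p.proj * φ.α i p.proj (c.χ p.proj • (φ.e j).1 p.proj) = _
    rw [map_smul, hd]
    by_cases h : i = j
    · simp [h, prolongationFrame]; ring
    · simp [h, prolongationFrame]
  · change c.χ p.proj * φ.α i p.proj 0 = _
    simp [prolongationFrame]
  · change φ.χ p.proj * c.χ p.proj * (Module.finBasis ℝ G).coord k
      ((totalTangentTriv I p₀).linearMapAt ℝ p (c.field (fun p =>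
        ((baseTangentTriv I p₀.proj).linearMapAt ℝ p.proj
          (L.anchor p.proj ((φ.e j).1 p.proj)), 0)) p)).2 = _
    rw [mul_assoc, hcoord]
    simp [prolongationFrame]
  · change φ.χ p.proj * c.χ p.proj * (Module.finBasis ℝ G).coord k
      ((totalTangentTriv I p₀).linearMapAt ℝ p (c.field (fun _ =>
        (0, Module.finBasis ℝ G l)) p)).2 = _
    rw [mul_assoc, hcoord]
    by_cases h : k = l
    · simp [h, prolongationFrame]; ring
    · simp [h, prolongationFrame]

end ChartCutoff

variable [FiniteDimensional ℝ EM] [T2Space M]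

variable (I G W) in
theorem exists_chartCutoff (x₀ : M) : Nonempty (ChartCutoff I G W x₀) := by
  obtain ⟨χ, h, h1, hs⟩ := exists_smooth_cutoff (I := I) (Filter.inter_mem
    ((trivializationAt G W x₀).open_baseSet.mem_nhds (mem_baseSet_trivializationAt G W x₀))
    ((chartAt HM x₀).open_source.mem_nhds (mem_chart_source HM x₀)))
  exact ⟨⟨χ, h, h1, hs⟩⟩

/-- Through every vertical vector passes a section of the prolongation with vanishing first
component. -/
theorem exists_vertical_section {p : TotalSpace G W} {v : TangentSpace (I.prod 𝓘(ℝ, G)) p}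
    (hv : mfderiv (I.prod 𝓘(ℝ, G)) I (TotalSpace.proj : TotalSpace G W → M) p v = 0) :
    ∃ T : prolongationSections (I.prod 𝓘(ℝ, G)) L (TotalSpace.proj : TotalSpace G W → M)
      (contMDiff_proj W), (∀ q, (T.1 q).1.1 = 0) ∧ (T.1 p).1.2 = v := by
  obtain ⟨c⟩ := exists_chartCutoff I G W p.proj
  have hp := self_mem_totalTangentTriv (I := I) p
  refine ⟨c.vertical L ((totalTangentTriv I p).linearMapAt ℝ p v).2, fun q => rfl, ?_⟩
  change c.field (fun _ => (0, _)) p = v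
  apply (totalTangentTriv I p).linearMapAt_injective hp
  rw [c.linearMapAt_field hp, c.eq_one, one_smul]
  exact Prod.ext ((mfderiv_proj_eq_zero_iff hp v).1 hv).symm rfl

variable [FiniteDimensional ℝ F] [FiniteDimensional ℝ G]

open Classical in
/-- Around every point the prolongation possesses a frame of projectable sections. -/
theorem exists_projectable_frame (p₀ : TotalSpace G W) :
    ∃ ψ : CutoffFrame (I.prod 𝓘(ℝ, G)) (prolongationSections (I.prod 𝓘(ℝ, G)) L
      (TotalSpace.proj : TotalSpace G W → M) (contMDiff_proj W)) p₀,
      ψ.IsDual ∧ Fintype.card ψ.ι = Module.finrank ℝ F + Module.finrank ℝ G ∧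
      ∀ i, ∃ σ : smoothSections I F A, ∀ p, ((ψ.e i).1 p).1.1 = σ.1 p.proj := by
  obtain ⟨c⟩ := exists_chartCutoff I G W p₀.proj
  let t := trivializationAt F A p₀.proj
  obtain ⟨χ, hχ, h1, hs⟩ := exists_smooth_cutoff (I := I)
    (t.open_baseSet.mem_nhds (mem_baseSet_trivializationAt F A p₀.proj))
  refine ⟨c.prolongationFrame L (trivializationFrame t hχ h1 hs)
    (fun i s h => trivializationFrame_α_along t hχ h1 hs (contMDiff_proj W) h i), ?_, ?_, ?_⟩
  · exact c.prolongationFrame_isDual L _ _ (trivializationFrame_isDual t hχ h1 hs)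
  · change Fintype.card (Fin _ ⊕ Fin _) = _
    simp
  · rintro (i | k)
    -- The cut-off is pulled back from the base, so the cut-off lift of e_i is still projectable,
    -- onto χ e_i rather than e_i. Vertical sections project onto zero.
    · exact ⟨⟨fun x => c.χ x • ((trivializationFrame t hχ h1 hs).e i).1 x,
        ContMDiff.smul_section c.smooth ((trivializationFrame t hχ h1 hs).e i).2⟩, fun p => rfl⟩
    · exact ⟨0, fun p => rfl⟩

theorem isSmoothBundleOfRank_prolongation :
    IsSmoothBundleOfRank (I.prod 𝓘(ℝ, G)) (prolongationSections (I.prod 𝓘(ℝ, G)) L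
      (TotalSpace.proj : TotalSpace G W → M) (contMDiff_proj W))
      (Module.finrank ℝ F + Module.finrank ℝ G) :=
  isSmoothBundleOfRank_of_frames fun p₀ =>
    let ⟨ψ, h, h', _⟩ := exists_projectable_frame L p₀
    ⟨ψ, h, h'⟩

end ProlongationFrames

/-! ## One-forms -/

section OneForms

variable {EB : Type*} [NormedAddCommGroup EB] [NormedSpace ℝ EB] {HB : Type*} [TopologicalSpace HB]
  {J : ModelWithCorners ℝ EB HB} {B : Type*} [TopologicalSpace B] [ChartedSpace HB B]
  {V : B → Type*} [∀ b, AddCommGroup (V b)] [∀ b, Module ℝ (V b)] {Γ : Submodule ℝ (∀ b, V b)}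

variable (J Γ) in
/-- The space of smooth one-forms. -/
def oneForms : Submodule ℝ (∀ b, V b →ₗ[ℝ] ℝ) where
  carrier := {a | IsSmoothOneForm J Γ a}
  add_mem' ha ha' X := (ha X).add (ha' X)
  zero_mem' _ := contMDiff_const
  smul_mem' _ _ ha X := contMDiff_const.mul (ha X)

/-- The frame of one-forms dual to a frame. -/
def CutoffFrame.dual {b₀ : B} (φ : CutoffFrame J Γ b₀) : CutoffFrame J (oneForms J Γ) b₀ where
  ι := φ.ι
  χ := φ.χ
  e i := ⟨φ.α i, φ.α_smooth i⟩
  α i b := LinearMap.applyₗ ((φ.e i).1 b)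
  χ_smooth := φ.χ_smooth
  χ_eq_one := φ.χ_eq_one
  α_smooth i a := a.2 (φ.e i)
  -- The identity ∑ α_i ⊗ e_i = χ · id, transposed.
  smul_eq b a := by
    ext v
    have h := congrArg a (φ.smul_eq b v)
    simp only [map_smul, map_sum, smul_eq_mul] at h
    simp only [LinearMap.smul_apply, smul_eq_mul, h, LinearMap.sum_apply, LinearMap.applyₗ_apply_apply]
    exact Finset.sum_congr rfl fun i _ => mul_comm _ _

theorem HasCutoffFrames.oneForms (hΓ : HasCutoffFrames J Γ) :
    HasCutoffFrames J (oneForms J Γ) where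
  smul_mem _ hf _ ha X := hf.mul (ha X)
  frame b₀ := (hΓ.frame b₀).map CutoffFrame.dual

/-- One-forms separate the vectors of a fibre. -/
theorem HasCutoffFrames.eq_of_oneForms (hΓ : HasCutoffFrames J Γ) {b : B} {v w : V b}
    (h : ∀ a : _root_.oneForms J Γ, a.1 b v = a.1 b w) : v = w := by
  obtain ⟨φ⟩ := hΓ.frame b
  rw [φ.eq_sum v, φ.eq_sum w]
  exact Finset.sum_congr rfl fun i _ => by rw [h ⟨φ.α i, φ.α_smooth i⟩]

/-- A tensorial functional on one-forms is evaluation at a vector. -/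
theorem HasCutoffFrames.exists_vector (hΓ : HasCutoffFrames J Γ) {b : B}
    {Φ : _root_.oneForms J Γ →ₗ[ℝ] ℝ} (hΦ : IsTensorialAt J b Φ) :
    ∃ v : V b, ∀ a, a.1 b v = Φ a := by
  obtain ⟨φ⟩ := hΓ.frame b
  refine ⟨∑ i, Φ (φ.dual.e i) • (φ.e i).1 b, fun a => ?_⟩
  rw [φ.dual.apply_eq_sum hΓ.oneForms hΦ a, map_sum]
  refine Finset.sum_congr rfl fun i _ => ?_
  rw [map_smul, smul_eq_mul, smul_eq_mul, mul_comm]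
  rfl

theorem HasCutoffFrames.exists_section (hΓ : HasCutoffFrames J Γ) {b : B} (v : V b) :
    ∃ X : Γ, X.1 b = v := by
  obtain ⟨φ⟩ := hΓ.frame b
  exact ⟨φ.extend v, φ.extend_apply v⟩

end OneForms

/-! ## The Jacobi identity and uniqueness of brackets in frames -/

section Brackets

variable {EB : Type*} [NormedAddCommGroup EB] [NormedSpace ℝ EB] {HB : Type*} [TopologicalSpace HB]
  {J : ModelWithCorners ℝ EB HB} {B : Type*} [TopologicalSpace B] [ChartedSpace HB B]
  [IsManifold J ∞ B]
  {V : B → Type*} [∀ b, AddCommGroup (V b)] [∀ b, Module ℝ (V b)] {Γ : Submodule ℝ (∀ b, V b)}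

/-- The Jacobiator of a bracket. -/
def jacobiator (br : Γ →ₗ[ℝ] Γ →ₗ[ℝ] Γ) (X Y Z : Γ) : Γ :=
  br X (br Y Z) + br Y (br Z X) + br Z (br X Y)

theorem jacobiator_cyclic (br : Γ →ₗ[ℝ] Γ →ₗ[ℝ] Γ) (X Y Z : Γ) :
    jacobiator br X Y Z = jacobiator br Y Z X := by
  unfold jacobiator; abel

/-- The value at a point of the Jacobiator, as a linear function of the first argument. -/
def jacobiatorAt (br : Γ →ₗ[ℝ] Γ →ₗ[ℝ] Γ) (Y Z : Γ) (b : B) : Γ →ₗ[ℝ] V b :=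
  LinearMap.proj b ∘ₗ Γ.subtype ∘ₗ (br.flip (br Y Z) + br Y ∘ₗ br Z + br Z ∘ₗ br.flip Y)

theorem jacobiatorAt_apply (br : Γ →ₗ[ℝ] Γ →ₗ[ℝ] Γ) (X Y Z : Γ) (b : B) :
    jacobiatorAt br Y Z b X = (jacobiator br X Y Z).1 b := rfl

variable {anchor : ∀ b, V b →ₗ[ℝ] TangentSpace J b} {br : Γ →ₗ[ℝ] Γ →ₗ[ℝ] Γ}

/-- With f in one slot, terms with a single derivative of f times a bracket cancel in pairs. The
second derivatives leave [ρY, ρZ](f) X, which cancels against ρ[Y, Z](f) X. The axioms are listed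
separately because this serves to prove the Jacobi identity, before a `LieAlgebroid` is available.
-/
theorem isTensorialAt_jacobiatorAt [CompleteSpace EB] (hΓ : HasCutoffFrames J Γ)
    (hsmooth : ∀ X : Γ,
      ContMDiff J J.tangent ∞ (fun b => (⟨b, anchor b (X.1 b)⟩ : TangentBundle J B)))
    (hself : ∀ X : Γ, br X X = 0)
    (hanchor : ∀ (X Y : Γ) (b : B), anchor b ((br X Y).1 b) =
      mlieBracket J (fun c => anchor c (X.1 c)) (fun c => anchor c (Y.1 c)) b)
    (hleibniz : ∀ (X Y fY : Γ) (f : B → ℝ), ContMDiff J 𝓘(ℝ, ℝ) ∞ f →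
      (∀ b, fY.1 b = f b • Y.1 b) → ∀ b, (br X fY).1 b =
        mvfderiv J f b (anchor b (X.1 b)) • Y.1 b + f b • (br X Y).1 b)
    (Y Z : Γ) (b : B) : IsTensorialAt J b (jacobiatorAt br Y Z b) := by
  intro f hf X fX hfX
  have hswap : ∀ X Y, br X Y = -br Y X := fun X Y => by
    have h := hself (X + Y)
    simp only [map_add, LinearMap.add_apply, hself, zero_add, add_zero] at h
    exact eq_neg_of_add_eq_zero_right h
  have hfX' : fX = hΓ.smul f hf X := Subtype.ext (funext hfX)
  have hDf : ∀ U : Γ, ContMDiff J 𝓘(ℝ, ℝ) ∞ fun c => mvfderiv J f c (anchor c (U.1 c)) :=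
    fun U => contMDiff_mvfderiv_apply (hsmooth U) hf
  have hright : ∀ U Y, br U (hΓ.smul f hf Y) =
      hΓ.smul _ (hDf U) Y + hΓ.smul f hf (br U Y) := fun U Y =>
    Subtype.ext (funext fun c => hleibniz U Y _ f hf (fun _ => rfl) c)
  have hright2 : ∀ U U' Y, br U (hΓ.smul _ (hDf U') Y) =
      hΓ.smul _ (contMDiff_mvfderiv_apply (hsmooth U) (hDf U')) Y +
        hΓ.smul _ (hDf U') (br U Y) := fun U U' Y =>
    Subtype.ext (funext fun c => hleibniz U Y _ _ (hDf U') (fun _ => rfl) c)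
  have hcomm := mvfderiv_mlieBracket_apply (hsmooth Y) (hsmooth Z) hf b
  rw [← hanchor] at hcomm
  simp only [jacobiatorAt_apply, jacobiator]
  rw [hfX', hswap (hΓ.smul f hf X) (br Y Z), hswap (hΓ.smul f hf X) Y, hright, hright, hright,
    map_neg, map_add, map_add, hright, hright, hright2, hright2, hswap X (br Y Z), hswap X Y,
    map_neg]
  simp only [Submodule.coe_add, Submodule.coe_neg, Pi.add_apply, Pi.neg_apply,
    HasCutoffFrames.smul, hcomm]
  module

/-- The Jacobi identity holds if it holds on frames. -/
theorem jacobi_of_frames [CompleteSpace EB] (hΓ : HasCutoffFrames J Γ)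
    (hsmooth : ∀ X : Γ,
      ContMDiff J J.tangent ∞ (fun b => (⟨b, anchor b (X.1 b)⟩ : TangentBundle J B)))
    (hself : ∀ X : Γ, br X X = 0)
    (hanchor : ∀ (X Y : Γ) (b : B), anchor b ((br X Y).1 b) =
      mlieBracket J (fun c => anchor c (X.1 c)) (fun c => anchor c (Y.1 c)) b)
    (hleibniz : ∀ (X Y fY : Γ) (f : B → ℝ), ContMDiff J 𝓘(ℝ, ℝ) ∞ f →
      (∀ b, fY.1 b = f b • Y.1 b) → ∀ b, (br X fY).1 b =
        mvfderiv J f b (anchor b (X.1 b)) • Y.1 b + f b • (br X Y).1 b)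
    (h : ∀ b, ∃ φ : CutoffFrame J Γ b, ∀ i j k,
      (jacobiator br (φ.e i) (φ.e j) (φ.e k)).1 b = 0) (X Y Z : Γ) :
    br X (br Y Z) + br Y (br Z X) + br Z (br X Y) = 0 := by
  have ht := isTensorialAt_jacobiatorAt hΓ hsmooth hself hanchor hleibniz
  ext b
  obtain ⟨φ, hφ⟩ := h b
  have h1 : ∀ X j k, (jacobiator br X (φ.e j) (φ.e k)).1 b = 0 := fun X j k =>
    φ.eq_zero hΓ (ht (φ.e j) (φ.e k) b) (fun i => hφ i j k) X
  -- Tensoriality is known in the first slot; cyclic symmetry brings the other slots there, freeing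
  -- one frame element at a time.
  have h2 : ∀ X Y k, (jacobiator br X Y (φ.e k)).1 b = 0 := fun X Y k => by
    rw [jacobiator_cyclic]
    refine φ.eq_zero hΓ (ht (φ.e k) X b) (fun i => ?_) Y
    rw [jacobiatorAt_apply, ← jacobiator_cyclic]
    exact h1 X i k
  have h3 : (jacobiator br Z X Y).1 b = 0 := by
    refine φ.eq_zero hΓ (ht X Y b) (fun i => ?_) Z
    rw [jacobiatorAt_apply, jacobiator_cyclic]
    exact h2 X Y i
  rw [jacobiator_cyclic] at h3
  exact h3

namespace LieAlgebroid

/-- The value at a point of the difference of the brackets of two Lie algebroids. -/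
def bracketDiffAt (K K' : LieAlgebroid J Γ) (X : Γ) (b : B) : Γ →ₗ[ℝ] V b :=
  LinearMap.proj b ∘ₗ Γ.subtype ∘ₗ (K.bracket X - K'.bracket X)

theorem bracketDiffAt_apply (K K' : LieAlgebroid J Γ) (X Y : Γ) (b : B) :
    bracketDiffAt K K' X b Y = (K.bracket X Y).1 b - (K'.bracket X Y).1 b := rfl

/-- Two Lie algebroids with the same anchor and the same brackets of frames coincide. -/
theorem eq_of_frames (hΓ : HasCutoffFrames J Γ) {K K' : LieAlgebroid J Γ}
    (hanchor : K.anchor = K'.anchor)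
    (h : ∀ b, ∃ φ : CutoffFrame J Γ b, ∀ i j,
      (K.bracket (φ.e i) (φ.e j)).1 b = (K'.bracket (φ.e i) (φ.e j)).1 b) : K = K' := by
  refine LieAlgebroid.ext hanchor ?_
  -- The derivative terms of the two Leibniz rules agree because the anchors do, so they drop out of
  -- the difference.
  have ht : ∀ X b, IsTensorialAt J b (bracketDiffAt K K' X b) := by
    intro X b f hf Y fY hfY
    rw [bracketDiffAt_apply, bracketDiffAt_apply, K.leibniz X Y fY f hf hfY,
      K'.leibniz X Y fY f hf hfY, hanchor]
    module
  ext X Y b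
  obtain ⟨φ, hφ⟩ := h b
  have h1 : ∀ i Y, bracketDiffAt K K' (φ.e i) b Y = 0 := fun i Y =>
    φ.eq_zero hΓ (ht (φ.e i) b) (fun j => sub_eq_zero.2 (hφ i j)) Y
  have h2 : bracketDiffAt K K' X b Y = 0 := by
    refine φ.eq_zero hΓ (ht X b) (fun j => ?_) Y
    have h3 := h1 j X
    rw [bracketDiffAt_apply, sub_eq_zero] at h3 ⊢
    rw [K.bracket_swap, K'.bracket_swap, Submodule.coe_neg, Submodule.coe_neg, Pi.neg_apply,
      Pi.neg_apply, h3]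
  exact sub_eq_zero.1 h2

end LieAlgebroid

end Brackets

/-! ## The differential of one-forms as a map to two-forms -/

namespace LieAlgebroid

variable {EB : Type*} [NormedAddCommGroup EB] [NormedSpace ℝ EB] {HB : Type*} [TopologicalSpace HB]
  {J : ModelWithCorners ℝ EB HB} {B : Type*} [TopologicalSpace B] [ChartedSpace HB B]
  [IsManifold J ∞ B]
  {V : B → Type*} [∀ b, AddCommGroup (V b)] [∀ b, Module ℝ (V b)]
  {Γ : Submodule ℝ (∀ b, V b)} (L : LieAlgebroid J Γ) (hΓ : HasCutoffFrames J Γ)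

/-- The differential of a one-form. -/
def dForm (a : oneForms J Γ) : TwoForm J Γ := (L.exists_twoForm_eval_eq hΓ a.2).choose

theorem dForm_apply (a : oneForms J Γ) (X Y : Γ) (b : B) :
    (L.dForm hΓ a).toFun b (X.1 b) (Y.1 b) =
      L.deriv X (fun c => a.1 c (Y.1 c)) b - L.deriv Y (fun c => a.1 c (X.1 c)) b -
        a.1 b ((L.bracket X Y).1 b) :=
  congrFun ((L.exists_twoForm_eval_eq hΓ a.2).choose_spec X Y) b

theorem dForm_add (a a' : oneForms J Γ) (b : B) (v w : V b) :
    (L.dForm hΓ (a + a')).toFun b v w = (L.dForm hΓ a).toFun b v w + (L.dForm hΓ a').toFun b v w := by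
  obtain ⟨X, rfl⟩ := hΓ.exists_section v
  obtain ⟨Y, rfl⟩ := hΓ.exists_section w
  have h := fun X Y : Γ => congrFun (L.deriv_add X (a.2 Y) (a'.2 Y)) b
  have h' : ∀ X Y : Γ, L.deriv X (fun c => (a + a').1 c (Y.1 c)) b =
      L.deriv X (fun c => a.1 c (Y.1 c)) b + L.deriv X (fun c => a'.1 c (Y.1 c)) b := h
  rw [dForm_apply, dForm_apply, dForm_apply, h', h']
  simp only [Submodule.coe_add, Pi.add_apply, LinearMap.add_apply]
  ring

theorem dForm_const_smul (r : ℝ) (a : oneForms J Γ) (b : B) (v w : V b) :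
    (L.dForm hΓ (r • a)).toFun b v w = r * (L.dForm hΓ a).toFun b v w := by
  obtain ⟨X, rfl⟩ := hΓ.exists_section v
  obtain ⟨Y, rfl⟩ := hΓ.exists_section w
  have h := fun X Y : Γ => congrFun (L.deriv_const_smul X r (a.2 Y)) b
  have h' : ∀ X Y : Γ, L.deriv X (fun c => (r • a).1 c (Y.1 c)) b =
      r * L.deriv X (fun c => a.1 c (Y.1 c)) b := h
  rw [dForm_apply, dForm_apply, h', h']
  simp only [Submodule.coe_smul, Pi.smul_apply, LinearMap.smul_apply, smul_eq_mul]
  ring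

theorem dForm_smul {f : B → ℝ} (hf : ContMDiff J 𝓘(ℝ, ℝ) ∞ f) {a fa : oneForms J Γ}
    (h : ∀ b, fa.1 b = f b • a.1 b) (b : B) (v w : V b) :
    (L.dForm hΓ fa).toFun b v w = f b * (L.dForm hΓ a).toFun b v w +
      mvfderiv J f b (L.anchor b v) * a.1 b w - mvfderiv J f b (L.anchor b w) * a.1 b v := by
  obtain ⟨X, rfl⟩ := hΓ.exists_section v
  obtain ⟨Y, rfl⟩ := hΓ.exists_section w
  have h' : ∀ X Y : Γ, L.deriv X (fun c => fa.1 c (Y.1 c)) b =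
      L.deriv X f b * a.1 b (Y.1 b) + f b * L.deriv X (fun c => a.1 c (Y.1 c)) b := by
    intro X Y
    rw [← L.deriv_mul X hf (a.2 Y)]
    simp [h]
  rw [dForm_apply, dForm_apply, h', h', h]
  simp only [LinearMap.smul_apply, smul_eq_mul, deriv]
  ring

theorem dForm_swap (a : oneForms J Γ) (b : B) (v w : V b) :
    (L.dForm hΓ a).toFun b v w = -(L.dForm hΓ a).toFun b w v := by
  have h := (L.dForm hΓ a).alternating b (v + w)
  simp only [map_add, LinearMap.add_apply, (L.dForm hΓ a).alternating, zero_add, add_zero] at h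
  linarith

/-- The differential of a function. -/
def dFunction {f : B → ℝ} (hf : ContMDiff J 𝓘(ℝ, ℝ) ∞ f) : oneForms J Γ :=
  ⟨fun b => (mvfderiv J f b).toLinearMap ∘ₗ L.anchor b, fun X => L.contMDiff_deriv X hf⟩

/-- That d(df) = 0 expresses the compatibility of ρ with brackets. It is what makes the prolongation
bracket satisfy the fibre condition. -/
theorem dForm_dFunction [CompleteSpace EB] {f : B → ℝ} (hf : ContMDiff J 𝓘(ℝ, ℝ) ∞ f) (b : B)
    (v w : V b) : (L.dForm hΓ (L.dFunction hf)).toFun b v w = 0 := by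
  obtain ⟨X, rfl⟩ := hΓ.exists_section v
  obtain ⟨Y, rfl⟩ := hΓ.exists_section w
  rw [dForm_apply]
  have h := congrFun (L.deriv_bracket X Y hf) b
  change L.deriv X (L.deriv Y f) b - L.deriv Y (L.deriv X f) b - L.deriv (L.bracket X Y) f b = 0
  rw [h, Pi.sub_apply, sub_self]

end LieAlgebroid

/-- Smooth functions separate tangent vectors. -/
theorem eq_of_mvfderiv_eq {EM : Type*} [NormedAddCommGroup EM] [NormedSpace ℝ EM]
    [FiniteDimensional ℝ EM] {HM : Type*} [TopologicalSpace HM] {I : ModelWithCorners ℝ EM HM}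
    {M : Type*} [TopologicalSpace M] [ChartedSpace HM M] [IsManifold I ∞ M] [T2Space M] {x : M}
    {u u' : TangentSpace I x}
    (h : ∀ f : M → ℝ, ContMDiff I 𝓘(ℝ, ℝ) ∞ f → mvfderiv I f x u = mvfderiv I f x u') : u = u' := by
  let ψ : SmoothBumpFunction I x := Classical.arbitrary _
  -- A bump function makes the chart a global smooth map with the same germ at x. Its compositions
  -- with linear functionals are the test functions.
  have hsm : ContMDiff I 𝓘(ℝ, EM) ∞ fun y => ψ y • extChartAt I x y :=
    ψ.contMDiff_smul contMDiffOn_extChartAt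
  have hev : (fun y => ψ y • extChartAt I x y) =ᶠ[𝓝 x] extChartAt I x := by
    filter_upwards [ψ.eventuallyEq_one] with y hy
    simp [hy]
  apply (isInvertible_mfderiv_extChartAt (mem_extChartAt_source (I := I) x)).injective
  rw [← hev.mfderiv_eq]
  refine (SeparatingDual.eq_iff_forall_dual_eq (R := ℝ) (V := EM)).2 fun l => ?_
  have hl := h (l ∘ fun y => ψ y • extChartAt I x y) (l.contDiff.contMDiff.comp hsm)
  have hcomp := mvfderiv_comp_apply (I := 𝓘(ℝ, EM)) x (g := l)
    (l.contDiff.contMDiff.mdifferentiableAt_of_smooth _) (hsm.mdifferentiableAt_of_smooth x)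
  rw [hcomp, hcomp] at hl
  have hd : mvfderiv 𝓘(ℝ, EM) l (ψ x • extChartAt I x x) = l := by
    rw [mvfderiv, mfderiv_eq_fderiv]
    exact l.fderiv
  rw [hd] at hl
  exact hl

/-! ## The bracket of a prolongation -/

section ProlongationBracket

variable {EM : Type*} [NormedAddCommGroup EM] [NormedSpace ℝ EM] {HM : Type*} [TopologicalSpace HM]
  {I : ModelWithCorners ℝ EM HM} {M : Type*} [TopologicalSpace M] [ChartedSpace HM M]
  [IsManifold I ∞ M]
  {F : Type*} [NormedAddCommGroup F] [NormedSpace ℝ F]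
  {A : M → Type*} [TopologicalSpace (TotalSpace F A)] [∀ x, TopologicalSpace (A x)]
  [∀ x, AddCommGroup (A x)] [∀ x, Module ℝ (A x)]
  [FiberBundle F A] [VectorBundle ℝ F A] [ContMDiffVectorBundle ∞ F A I]
  {EP : Type*} [NormedAddCommGroup EP] [NormedSpace ℝ EP] {HP : Type*} [TopologicalSpace HP]
  {J : ModelWithCorners ℝ EP HP} {P : Type*} [TopologicalSpace P] [ChartedSpace HP P]
  [IsManifold J ∞ P]
  [FiniteDimensional ℝ EM] [T2Space M] [FiniteDimensional ℝ F] [CompleteSpace EP]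
  {L : LieAlgebroid I (smoothSections I F A)} {τ : P → M} {hτ : ContMDiff J I ∞ τ}

/-- The first component of a section of a prolongation. -/
def fstComp (S : prolongationSections J L τ hτ) (p : P) : A (τ p) := (S.1 p).1.1

/-- The vector field underlying a section of a prolongation. -/
def sndComp (S : prolongationSections J L τ hτ) (p : P) : TangentSpace J p := (S.1 p).1.2

theorem fstComp_smooth (S : prolongationSections J L τ hτ) :
    ContMDiff J (I.prod 𝓘(ℝ, F)) ∞ (fun p => (⟨τ p, fstComp S p⟩ : TotalSpace F A)) := S.2.1

theorem sndComp_smooth (S : prolongationSections J L τ hτ) :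
    ContMDiff J J.tangent ∞ (fun p => (⟨p, sndComp S p⟩ : TangentBundle J P)) := S.2.2

theorem anchor_fstComp (S : prolongationSections J L τ hτ) (p : P) :
    L.anchor (τ p) (fstComp S p) = mfderiv J I τ p (sndComp S p) :=
  mem_prolongationFiber.1 (S.1 p).2

theorem prolongationSections_ext {S T : prolongationSections J L τ hτ}
    (h1 : ∀ p, fstComp S p = fstComp T p) (h2 : ∀ p, sndComp S p = sndComp T p) : S = T :=
  Subtype.ext (funext fun p => Subtype.ext (Prod.ext (h1 p) (h2 p)))

theorem oneForm_fstComp_smooth (a : oneForms I (smoothSections I F A))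
    (S : prolongationSections J L τ hτ) :
    ContMDiff J 𝓘(ℝ, ℝ) ∞ (fun p => a.1 (τ p) (fstComp S p)) :=
  IsSmoothOneForm.contMDiff_along a.2 hτ (fstComp_smooth S)

/-- The value of a one-form on the first component of the bracket of two sections. -/
def bracketForm (S T : prolongationSections J L τ hτ) (p : P) :
    oneForms I (smoothSections I F A) →ₗ[ℝ] ℝ where
  -- Cartan's formula for da solved for the bracket term. Derivatives are taken on P along the
  -- second components, so S and T need not be projectable.
  toFun a := mvfderiv J (fun q => a.1 (τ q) (fstComp T q)) p (sndComp S p) -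
    mvfderiv J (fun q => a.1 (τ q) (fstComp S q)) p (sndComp T p) -
    (L.dForm hasCutoffFrames_smoothSections a).toFun (τ p) (fstComp S p) (fstComp T p)
  map_add' a a' := by
    have h := fun (S : prolongationSections J L τ hτ) v => mvfderiv_add_apply
      (oneForm_fstComp_smooth a S) (oneForm_fstComp_smooth a' S) p v
    simp only [Submodule.coe_add, Pi.add_apply, LinearMap.add_apply, h, L.dForm_add]
    ring
  map_smul' c a := by
    have h := fun (S : prolongationSections J L τ hτ) v => mvfderiv_const_mul_apply c
      (oneForm_fstComp_smooth a S) p v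
    simp only [Submodule.coe_smul, Pi.smul_apply, LinearMap.smul_apply, smul_eq_mul, h,
      L.dForm_const_smul, RingHom.id_apply]
    ring

theorem bracketForm_apply (S T : prolongationSections J L τ hτ) (p : P)
    (a : oneForms I (smoothSections I F A)) : bracketForm S T p a =
      mvfderiv J (fun q => a.1 (τ q) (fstComp T q)) p (sndComp S p) -
      mvfderiv J (fun q => a.1 (τ q) (fstComp S q)) p (sndComp T p) -
      (L.dForm hasCutoffFrames_smoothSections a).toFun (τ p) (fstComp S p) (fstComp T p) := rfl

theorem mvfderiv_comp_sndComp (S : prolongationSections J L τ hτ) {f : M → ℝ}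
    (hf : ContMDiff I 𝓘(ℝ, ℝ) ∞ f) (p : P) :
    mvfderiv J (fun q => f (τ q)) p (sndComp S p) =
      mvfderiv I f (τ p) (L.anchor (τ p) (fstComp S p)) := by
  rw [anchor_fstComp]
  exact mvfderiv_comp_apply p (hf.mdifferentiableAt_of_smooth _) (hτ.mdifferentiableAt_of_smooth p) _

/-- By the fibre condition X_S(f ∘ τ) = ρ(S₁)(f), so the terms that the product rule creates are
those of df ∧ a in d(fa), and they cancel. -/
theorem isTensorialAt_bracketForm (S T : prolongationSections J L τ hτ) (p : P) :
    IsTensorialAt I (τ p) (bracketForm S T p) := by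
  intro f hf a fa hfa
  have h : ∀ (S T : prolongationSections J L τ hτ),
      mvfderiv J (fun q => fa.1 (τ q) (fstComp T q)) p (sndComp S p) =
      mvfderiv I f (τ p) (L.anchor (τ p) (fstComp S p)) * a.1 (τ p) (fstComp T p) +
      f (τ p) * mvfderiv J (fun q => a.1 (τ q) (fstComp T q)) p (sndComp S p) := by
    intro S T
    have hfτ : ContMDiff J 𝓘(ℝ, ℝ) ∞ fun q => f (τ q) := hf.comp hτ
    rw [← mvfderiv_comp_sndComp S hf, ← mvfderiv_mul_apply hfτ (oneForm_fstComp_smooth a T)]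
    simp [hfa]
  rw [bracketForm_apply, bracketForm_apply, h, h, L.dForm_smul _ hf hfa, smul_eq_mul]
  ring

/-- The first component of the bracket of two sections. -/
def bracketFst (S T : prolongationSections J L τ hτ) (p : P) : A (τ p) :=
  (hasCutoffFrames_smoothSections.exists_vector (isTensorialAt_bracketForm S T p)).choose

theorem oneForm_bracketFst (S T : prolongationSections J L τ hτ) (p : P)
    (a : oneForms I (smoothSections I F A)) :
    a.1 (τ p) (bracketFst S T p) = bracketForm S T p a :=
  (hasCutoffFrames_smoothSections.exists_vector (isTensorialAt_bracketForm S T p)).choose_spec a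

theorem eq_bracketFst (S T : prolongationSections J L τ hτ) (p : P) {v : A (τ p)}
    (h : ∀ a : oneForms I (smoothSections I F A), bracketForm S T p a = a.1 (τ p) v) :
    bracketFst S T p = v :=
  hasCutoffFrames_smoothSections.eq_of_oneForms fun a => by rw [oneForm_bracketFst, h]

theorem bracketFst_smooth (S T : prolongationSections J L τ hτ) :
    ContMDiff J (I.prod 𝓘(ℝ, F)) ∞ (fun p => (⟨τ p, bracketFst S T p⟩ : TotalSpace F A)) := by
  refine contMDiff_along_of_oneForms hτ fun a ha => ?_
  have h : (fun p => a (τ p) (bracketFst S T p)) = fun p => bracketForm S T p ⟨a, ha⟩ :=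
    funext fun p => oneForm_bracketFst S T p ⟨a, ha⟩
  rw [h]
  exact ((contMDiff_mvfderiv_apply (sndComp_smooth S) (oneForm_fstComp_smooth ⟨a, ha⟩ T)).sub
    (contMDiff_mvfderiv_apply (sndComp_smooth T) (oneForm_fstComp_smooth ⟨a, ha⟩ S))).sub
    (TwoForm.contMDiff_along _ hτ (fstComp_smooth S) (fstComp_smooth T))

/-- Tested against df: the term d(df) vanishes, and the other two form the commutator of X_S and X_T
on f ∘ τ. This places the bracket in the fibres of the prolongation. -/
theorem anchor_bracketFst (S T : prolongationSections J L τ hτ) (p : P) :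
    L.anchor (τ p) (bracketFst S T p) =
      mfderiv J I τ p (mlieBracket J (sndComp S) (sndComp T) p) := by
  have : CompleteSpace EM := FiniteDimensional.complete ℝ EM
  refine eq_of_mvfderiv_eq fun f hf => ?_
  refine (oneForm_bracketFst S T p (L.dFunction hf)).trans ?_
  rw [bracketForm_apply, L.dForm_dFunction, sub_zero]
  have h : ∀ S : prolongationSections J L τ hτ,
      (fun q => (L.dFunction hf).1 (τ q) (fstComp S q)) =
        fun q => mvfderiv J (fun q => f (τ q)) q (sndComp S q) :=
    fun S => funext fun q => (mvfderiv_comp_sndComp S hf q).symm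
  have hfτ : ContMDiff J 𝓘(ℝ, ℝ) ∞ fun q => f (τ q) := hf.comp hτ
  rw [h, h, ← mvfderiv_mlieBracket_apply (sndComp_smooth S) (sndComp_smooth T) hfτ]
  exact mvfderiv_comp_apply p (hf.mdifferentiableAt_of_smooth _) (hτ.mdifferentiableAt_of_smooth p) _

/-- The bracket of two sections of a prolongation. -/
def prolongationBracketFun (S T : prolongationSections J L τ hτ) : prolongationSections J L τ hτ :=
  prolongationSection hτ (bracketFst S T) (mlieBracket J (sndComp S) (sndComp T))
    (bracketFst_smooth S T) (contMDiff_mlieBracket (sndComp_smooth S) (sndComp_smooth T))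
    (anchor_bracketFst S T)

theorem prolongationBracketFun_swap (S T : prolongationSections J L τ hτ) :
    prolongationBracketFun S T = -prolongationBracketFun T S := by
  refine prolongationSections_ext (fun p => eq_bracketFst S T p fun a => ?_)
    fun p => mlieBracket_swap_apply
  have h : a.1 (τ p) (fstComp (-prolongationBracketFun T S) p) = -bracketForm T S p a := by
    rw [← oneForm_bracketFst T S p a, ← map_neg]
    rfl
  rw [h, bracketForm_apply, bracketForm_apply, L.dForm_swap _ a _ (fstComp T p)]
  ring

theorem sndComp_mdifferentiableAt (S : prolongationSections J L τ hτ) (p : P) :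
    MDifferentiableAt J J.tangent (fun p => (⟨p, sndComp S p⟩ : TangentBundle J P)) p :=
  (sndComp_smooth S).mdifferentiableAt_of_smooth p

theorem prolongationBracketFun_add (S T T' : prolongationSections J L τ hτ) :
    prolongationBracketFun S (T + T') =
      prolongationBracketFun S T + prolongationBracketFun S T' := by
  refine prolongationSections_ext (fun p => eq_bracketFst S _ p fun a => ?_)
    fun p => mlieBracket_add_right (sndComp_mdifferentiableAt T p) (sndComp_mdifferentiableAt T' p)
  have h : a.1 (τ p) (fstComp (prolongationBracketFun S T + prolongationBracketFun S T') p) =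
      bracketForm S T p a + bracketForm S T' p a := by
    rw [← oneForm_bracketFst, ← oneForm_bracketFst, ← map_add]
    rfl
  have h1 : ∀ q, fstComp (T + T') q = fstComp T q + fstComp T' q := fun q => rfl
  have h2 : sndComp (T + T') p = sndComp T p + sndComp T' p := rfl
  simp only [h, bracketForm_apply, h1, h2, map_add]
  rw [mvfderiv_add_apply (oneForm_fstComp_smooth a T) (oneForm_fstComp_smooth a T')]
  ring

/-- The Leibniz rule for the bracket of a prolongation. -/
theorem prolongationBracketFun_leibniz (S T fT : prolongationSections J L τ hτ) {f : P → ℝ}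
    (hf : ContMDiff J 𝓘(ℝ, ℝ) ∞ f) (h : ∀ p, fT.1 p = f p • T.1 p) (p : P) :
    (prolongationBracketFun S fT).1 p = mvfderiv J f p (sndComp S p) • T.1 p +
      f p • (prolongationBracketFun S T).1 p := by
  have h1 : ∀ q, fstComp fT q = f q • fstComp T q := fun q => congrArg (fun z => z.1.1) (h q)
  have h2 : ∀ q, sndComp fT q = f q • sndComp T q := fun q => congrArg (fun z => z.1.2) (h q)
  refine Subtype.ext (Prod.ext ?_ ?_)
  · change bracketFst S fT p =
      mvfderiv J f p (sndComp S p) • fstComp T p + f p • bracketFst S T p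
    refine eq_bracketFst S fT p fun a => ?_
    simp only [map_add, map_smul, oneForm_bracketFst, bracketForm_apply, h1, h2, smul_eq_mul]
    rw [mvfderiv_mul_apply hf (oneForm_fstComp_smooth a T)]
    ring
  · change mlieBracket J (sndComp S) (sndComp fT) p =
      mvfderiv J f p (sndComp S p) • sndComp T p + f p • mlieBracket J (sndComp S) (sndComp T) p
    rw [show sndComp fT = f • sndComp T from funext h2]
    exact mlieBracket_smul_right (hf.mdifferentiableAt_of_smooth p) (sndComp_mdifferentiableAt T p)

theorem prolongationBracketFun_const_smul (S T : prolongationSections J L τ hτ) (c : ℝ) :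
    prolongationBracketFun S (c • T) = c • prolongationBracketFun S T := by
  ext1
  ext1 p
  rw [prolongationBracketFun_leibniz S T (c • T) (f := fun _ => c) contMDiff_const fun p => rfl,
    mvfderiv_const_apply, zero_smul, zero_add]
  rfl

/-- The bracket of projectable sections. -/
theorem bracketFst_of_projectable {S T : prolongationSections J L τ hτ}
    {σ σ' : smoothSections I F A} (hS : ∀ p, fstComp S p = σ.1 (τ p))
    (hT : ∀ p, fstComp T p = σ'.1 (τ p)) (p : P) :
    bracketFst S T p = (L.bracket σ σ').1 (τ p) := by
  refine eq_bracketFst S T p fun a => ?_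
  simp only [bracketForm_apply, hS, hT, L.dForm_apply]
  -- For projectable sections the two derivatives descend to M and cancel those in da(σ, σ'),
  -- leaving a of the bracket of σ and σ'.
  rw [mvfderiv_comp_sndComp S (f := fun x => a.1 x (σ'.1 x)) (a.2 σ'),
    mvfderiv_comp_sndComp T (f := fun x => a.1 x (σ.1 x)) (a.2 σ), hS, hT]
  simp only [LieAlgebroid.deriv]
  ring

/-- The bracket of sections of a prolongation as a bilinear map. -/
def prolongationBracket : prolongationSections J L τ hτ →ₗ[ℝ] prolongationSections J L τ hτ →ₗ[ℝ]
    prolongationSections J L τ hτ :=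
  LinearMap.mk₂ ℝ prolongationBracketFun
    (fun S S' T => by
      rw [prolongationBracketFun_swap, prolongationBracketFun_add, prolongationBracketFun_swap S,
        prolongationBracketFun_swap S']
      exact neg_add (prolongationBracketFun T S) (prolongationBracketFun T S'))
    (fun c S T => by
      rw [prolongationBracketFun_swap, prolongationBracketFun_const_smul,
        prolongationBracketFun_swap S]
      exact (smul_neg c (prolongationBracketFun T S)).symm)
    prolongationBracketFun_add
    (fun c S T => prolongationBracketFun_const_smul S T c)

variable (J L τ hτ) in
/-- The prolongation has frames of projectable sections. -/
def HasProjectableFrames : Prop :=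
  ∀ p₀, ∃ ψ : CutoffFrame J (prolongationSections J L τ hτ) p₀,
    ∀ i, ∃ σ : smoothSections I F A, ∀ p, fstComp (ψ.e i) p = σ.1 (τ p)

theorem HasProjectableFrames.hasCutoffFrames (h : HasProjectableFrames J L τ hτ) :
    HasCutoffFrames J (prolongationSections J L τ hτ) :=
  ⟨prolongationSections_smul_mem, fun p₀ => ⟨(h p₀).choose⟩⟩

variable (J L τ) in
/-- The anchor of the prolongation. -/
def prolongationAnchor (p : P) : prolongationFiber J L τ p →ₗ[ℝ] TangentSpace J p :=
  LinearMap.snd ℝ (A (τ p)) (TangentSpace J p) ∘ₗ (prolongationFiber J L τ p).subtype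

theorem prolongationBracketFun_self (S : prolongationSections J L τ hτ) :
    prolongationBracketFun S S = 0 := by
  have h : prolongationBracketFun S S = -prolongationBracketFun S S :=
    prolongationBracketFun_swap S S
  have h2 : (2 : ℝ) • prolongationBracketFun S S = 0 := by
    refine (two_smul ℝ _).trans ?_
    conv_lhs => arg 2; rw [h]
    exact add_neg_cancel (prolongationBracketFun S S)
  exact (smul_eq_zero_iff_right two_ne_zero).1 h2

/-- The prolongation Lie algebroid. -/
def prolongationLieAlgebroid (h : HasProjectableFrames J L τ hτ) :
    LieAlgebroid J (prolongationSections J L τ hτ) where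
  anchor := prolongationAnchor J L τ
  bracket := prolongationBracket
  anchor_smooth S := S.2.2
  bracket_self := prolongationBracketFun_self
  jacobi := by
    -- On projectable frames brackets stay projectable, so the first component of the Jacobiator is
    -- that of L at τ(p); the second is the Jacobiator of vector fields.
    refine jacobi_of_frames (anchor := prolongationAnchor J L τ)
      h.hasCutoffFrames (fun S => S.2.2) prolongationBracketFun_self
      (fun S T p => rfl) (fun S T fT f hf hfT p => prolongationBracketFun_leibniz S T fT hf hfT p)
      fun p => ?_
    obtain ⟨ψ, hψ⟩ := h p
    refine ⟨ψ, fun i j k => ?_⟩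
    obtain ⟨σ, hσ⟩ := hψ i
    obtain ⟨σ', hσ'⟩ := hψ j
    obtain ⟨σ'', hσ''⟩ := hψ k
    refine Subtype.ext (Prod.ext ?_ ?_)
    · have hb : ∀ {S T : prolongationSections J L τ hτ} {σ σ' : smoothSections I F A},
          (∀ p, fstComp S p = σ.1 (τ p)) → (∀ p, fstComp T p = σ'.1 (τ p)) →
          ∀ p, fstComp (prolongationBracketFun S T) p = (L.bracket σ σ').1 (τ p) :=
        bracketFst_of_projectable
      have hL := congrArg (fun s : smoothSections I F A => s.1 (τ p)) (L.jacobi σ σ' σ'')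
      refine Eq.trans ?_ hL
      change bracketFst _ (prolongationBracketFun _ _) p +
        bracketFst _ (prolongationBracketFun _ _) p +
        bracketFst _ (prolongationBracketFun _ _) p = _
      rw [bracketFst_of_projectable hσ (hb hσ' hσ''), bracketFst_of_projectable hσ' (hb hσ'' hσ),
        bracketFst_of_projectable hσ'' (hb hσ hσ')]
      rfl
    · have hj := mlieBracket_jacobi (sndComp_smooth (ψ.e i) p) (sndComp_smooth (ψ.e j) p)
        (sndComp_smooth (ψ.e k) p)
      change mlieBracket J (sndComp (ψ.e i)) (mlieBracket J (sndComp (ψ.e j)) (sndComp (ψ.e k))) p +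
        mlieBracket J (sndComp (ψ.e j)) (mlieBracket J (sndComp (ψ.e k)) (sndComp (ψ.e i))) p +
        mlieBracket J (sndComp (ψ.e k)) (mlieBracket J (sndComp (ψ.e i)) (sndComp (ψ.e j))) p = 0
      have hn : mlieBracket J (sndComp (ψ.e j)) (mlieBracket J (sndComp (ψ.e k)) (sndComp (ψ.e i))) p
          = -mlieBracket J (sndComp (ψ.e j))
            (mlieBracket J (sndComp (ψ.e i)) (sndComp (ψ.e k))) p := by
        have h := congrArg (fun S => sndComp S p) (map_neg (prolongationBracket (ψ.e j))
          (prolongationBracket (ψ.e i) (ψ.e k)))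
        have hs := prolongationBracketFun_swap (ψ.e k) (ψ.e i)
        exact (congrArg (fun S => sndComp (prolongationBracketFun (ψ.e j) S) p) hs).trans h
      rw [hj, hn, mlieBracket_swap_apply (V := sndComp (ψ.e k))]
      abel
  anchor_bracket S T p := rfl
  leibniz S T fT f hf hfT p := prolongationBracketFun_leibniz S T fT hf hfT p

theorem isProlongation_prolongationLieAlgebroid (h : HasProjectableFrames J L τ hτ) :
    IsProlongation J L τ hτ (prolongationLieAlgebroid h) where
  anchor_eq _ _ := rfl
  bracket_eq _ _ _ _ hS hT p := Prod.ext (bracketFst_of_projectable hS hT p) rfl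

/-- The defining conditions fix the anchor and the brackets of projectable sections; frames of such
sections determine all other brackets. -/
theorem eq_prolongationLieAlgebroid (h : HasProjectableFrames J L τ hτ)
    {K : LieAlgebroid J (prolongationSections J L τ hτ)} (hK : IsProlongation J L τ hτ K) :
    K = prolongationLieAlgebroid h := by
  refine LieAlgebroid.eq_of_frames h.hasCutoffFrames ?_ fun p => ?_
  · ext p z
    exact hK.anchor_eq p z
  · obtain ⟨ψ, hψ⟩ := h p
    refine ⟨ψ, fun i j => ?_⟩
    obtain ⟨σ, hσ⟩ := hψ i
    obtain ⟨σ', hσ'⟩ := hψ j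
    exact Subtype.ext ((hK.bracket_eq _ _ σ σ' hσ hσ' p).trans
      ((isProlongation_prolongationLieAlgebroid h).bracket_eq _ _ σ σ' hσ hσ' p).symm)

end ProlongationBracket

/-! ## The symplectic form of a prolongation defined by a pairing -/

section Symplectic

variable {EM : Type*} [NormedAddCommGroup EM] [NormedSpace ℝ EM] {HM : Type*} [TopologicalSpace HM]
  {I : ModelWithCorners ℝ EM HM} {M : Type*} [TopologicalSpace M] [ChartedSpace HM M]
  [IsManifold I ∞ M]
  {F : Type*} [NormedAddCommGroup F] [NormedSpace ℝ F]
  {A : M → Type*} [TopologicalSpace (TotalSpace F A)] [∀ x, TopologicalSpace (A x)]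
  [∀ x, AddCommGroup (A x)] [∀ x, Module ℝ (A x)]
  [FiberBundle F A] [VectorBundle ℝ F A] [ContMDiffVectorBundle ∞ F A I]
  {G : Type*} [NormedAddCommGroup G] [NormedSpace ℝ G]
  {W : M → Type*} [TopologicalSpace (TotalSpace G W)] [∀ x, TopologicalSpace (W x)]
  [∀ x, AddCommGroup (W x)] [∀ x, Module ℝ (W x)]
  [FiberBundle G W] [VectorBundle ℝ G W] [ContMDiffVectorBundle ∞ G W I]
  [FiniteDimensional ℝ EM] [T2Space M] [FiniteDimensional ℝ F] [FiniteDimensional ℝ G]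
  {L : LieAlgebroid I (smoothSections I F A)}

theorem hasProjectableFrames : HasProjectableFrames (I.prod 𝓘(ℝ, G)) L
    (TotalSpace.proj : TotalSpace G W → M) (contMDiff_proj W) := fun p₀ =>
  let ⟨ψ, _, _, h⟩ := exists_projectable_frame L p₀
  ⟨ψ, h⟩

/-- Through every vector of the prolongation passes a projectable section. -/
theorem exists_projectable_section {p : TotalSpace G W}
    (z : prolongationFiber (I.prod 𝓘(ℝ, G)) L (TotalSpace.proj : TotalSpace G W → M) p) :
    ∃ (S : prolongationSections (I.prod 𝓘(ℝ, G)) L (TotalSpace.proj : TotalSpace G W → M)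
      (contMDiff_proj W)) (σ : smoothSections I F A),
      (∀ q, (S.1 q).1.1 = σ.1 q.proj) ∧ S.1 p = z := by
  obtain ⟨ψ, _, _, h⟩ := exists_projectable_frame L p
  choose σ hσ using h
  refine ⟨ψ.extend z, ∑ i, ψ.α i p z • σ i, fun q => ?_, ψ.extend_apply z⟩
  simp [CutoffFrame.extend, Finset.sum_apply, Prod.fst_sum, ← hσ]

/-- The prolongation contains vectors over all vectors of `A`. -/
theorem exists_mem_prolongationFiber {p : TotalSpace G W} (b : A p.proj) :
    ∃ z : prolongationFiber (I.prod 𝓘(ℝ, G)) L (TotalSpace.proj : TotalSpace G W → M) p,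
      z.1.1 = b := by
  obtain ⟨c⟩ := exists_chartCutoff I G W p.proj
  obtain ⟨σ, hσ⟩ := (hasCutoffFrames_smoothSections (I := I) (F := F) (A := A)).exists_section b
  refine ⟨(c.horizontal L σ).1 p, ?_⟩
  change c.χ p.proj • σ.1 p.proj = b
  rw [c.eq_one, one_smul, hσ]

/-- The one-form on a prolongation defined by a pairing. -/
def pairingForm (L : LieAlgebroid I (smoothSections I F A)) (β : ∀ x, W x →ₗ[ℝ] A x →ₗ[ℝ] ℝ)
    (p : TotalSpace G W) :
    prolongationFiber (I.prod 𝓘(ℝ, G)) L (TotalSpace.proj : TotalSpace G W → M) p →ₗ[ℝ] ℝ :=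
  β p.proj p.2 ∘ₗ LinearMap.fst ℝ (A p.proj) (TangentSpace (I.prod 𝓘(ℝ, G)) p) ∘ₗ
    Submodule.subtype _

/-- The differential of the one-form of a pairing, evaluated on a vertical vector. -/
theorem pairingForm_eval_vertical {β : ∀ x, W x →ₗ[ℝ] A x →ₗ[ℝ] ℝ}
    (hs : IsSmoothOneForm (I.prod 𝓘(ℝ, G)) (prolongationSections (I.prod 𝓘(ℝ, G)) L
      (TotalSpace.proj : TotalSpace G W → M) (contMDiff_proj W)) (pairingForm L β))
    {K : LieAlgebroid (I.prod 𝓘(ℝ, G)) (prolongationSections (I.prod 𝓘(ℝ, G)) L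
      (TotalSpace.proj : TotalSpace G W → M) (contMDiff_proj W))}
    (hK : IsProlongation (I.prod 𝓘(ℝ, G)) L _ (contMDiff_proj W) K)
    {Ω : TwoForm (I.prod 𝓘(ℝ, G)) (prolongationSections (I.prod 𝓘(ℝ, G)) L
      (TotalSpace.proj : TotalSpace G W → M) (contMDiff_proj W))}
    (hΩ : ∀ X Y, Ω.eval X Y = K.dOneForm (pairingForm L β) hs X Y) {p : TotalSpace G W}
    (z t : prolongationFiber (I.prod 𝓘(ℝ, G)) L (TotalSpace.proj : TotalSpace G W → M) p)
    (w : W p.proj) (ht : t.1 = (0, verticalLift I p w)) :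
    Ω.toFun p z t = -β p.proj w z.1.1 := by
  -- Extend z to a projectable S and t to a section T projecting onto 0. In S(λ(T)) - T(λ(S)) -
  -- λ([S, T]) the first term vanishes since λ(T) = 0, the last since [S, T] projects onto [σ, 0] =
  -- 0. On the fibre λ(S) is the linear function β(·, σ), which the vertical T differentiates to
  -- β(w, σ).
  obtain ⟨S, σ, hS, rfl⟩ := exists_projectable_section z
  obtain ⟨T, hT, hTp⟩ := exists_vertical_section L (mfderiv_proj_verticalLift (I := I) p w)
  obtain rfl : T.1 p = t := Subtype.ext ((Prod.ext (hT p) hTp).trans ht.symm)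
  have h := congrFun (hΩ S T) p
  rw [LieAlgebroid.dOneForm_apply] at h
  have hT' : (fun q => pairingForm L β q (T.1 q)) = fun _ => 0 := by
    funext q
    change β q.proj q.2 (T.1 q).1.1 = 0
    rw [hT, map_zero]
  have hST : pairingForm L β p ((K.bracket S T).1 p) = 0 := by
    change β p.proj p.2 ((K.bracket S T).1 p).1.1 = 0
    rw [hK.bracket_eq S T σ 0 hS hT, map_zero]
    exact map_zero _
  have hTS : K.deriv T (fun q => pairingForm L β q (S.1 q)) p = β p.proj w (σ.1 p.proj) := by
    rw [LieAlgebroid.deriv, hK.anchor_eq, hTp]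
    refine mvfderiv_verticalLift (hs S) w ((β p.proj).flip (σ.1 p.proj)) fun w' => ?_
    change β p.proj w' (S.1 ⟨p.proj, w'⟩).1.1 = β p.proj w' (σ.1 p.proj)
    rw [hS]
  have hd : K.deriv S (fun q => pairingForm L β q (T.1 q)) p = 0 := by
    rw [hT', LieAlgebroid.deriv, mvfderiv_const_apply]
  refine h.trans ?_
  rw [Pi.sub_apply, Pi.sub_apply, hd, hTS, hST, hS, zero_sub, sub_zero]

/-- A smooth fibrewise non-degenerate pairing between `W` and a Lie algebroid `A` defines a
symplectic section of the prolongation of `A` over `W`. -/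
theorem hasSymplecticProlongation_of_pairing (L : LieAlgebroid I (smoothSections I F A))
    (β : ∀ x, W x →ₗ[ℝ] A x →ₗ[ℝ] ℝ)
    (hβ : ∀ s : ∀ p : TotalSpace G W, A p.proj, ContMDiff (I.prod 𝓘(ℝ, G)) (I.prod 𝓘(ℝ, F)) ∞
      (fun p => (⟨p.proj, s p⟩ : TotalSpace F A)) →
      ContMDiff (I.prod 𝓘(ℝ, G)) 𝓘(ℝ, ℝ) ∞ (fun p => β p.proj p.2 (s p)))
    (hl : ∀ x (w : W x), (∀ b, β x w b = 0) → w = 0)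
    (hr : ∀ x (b : A x), (∀ w, β x w b = 0) → b = 0) :
    HasSymplecticProlongation (I.prod 𝓘(ℝ, G)) L (TotalSpace.proj : TotalSpace G W → M)
      (contMDiff_proj W) (Module.finrank ℝ F + Module.finrank ℝ G) := by
  have : CompleteSpace (EM × G) := FiniteDimensional.complete ℝ _
  have hf : HasProjectableFrames (I.prod 𝓘(ℝ, G)) L (TotalSpace.proj : TotalSpace G W → M)
    (contMDiff_proj W) := hasProjectableFrames
  have hK := isProlongation_prolongationLieAlgebroid hf
  refine ⟨isSmoothBundleOfRank_prolongation L, prolongationLieAlgebroid hf, hK,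
    fun K' hK' => eq_prolongationLieAlgebroid hf hK', ?_⟩
  have hs : IsSmoothOneForm (I.prod 𝓘(ℝ, G)) (prolongationSections (I.prod 𝓘(ℝ, G)) L
      (TotalSpace.proj : TotalSpace G W → M) (contMDiff_proj W)) (pairingForm L β) :=
    fun S => hβ _ S.2.1
  obtain ⟨Ω, hΩ⟩ := (prolongationLieAlgebroid hf).exists_twoForm_eval_eq hf.hasCutoffFrames hs
  refine ⟨Ω, fun p z hz => ?_, LieAlgebroid.d_eq_zero_of_exact _ hs hΩ⟩
  -- Testing z against all vertical vectors annihilates its A-component.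
  have hb : z.1.1 = 0 := hr _ _ fun w => by
    have hm : ((0, verticalLift I p w) : A p.proj × TangentSpace (I.prod 𝓘(ℝ, G)) p) ∈
        prolongationFiber (I.prod 𝓘(ℝ, G)) L (TotalSpace.proj : TotalSpace G W → M) p :=
      mem_prolongationFiber.2 (by rw [map_zero, mfderiv_proj_verticalLift])
    have h := pairingForm_eval_vertical hs hK hΩ z ⟨_, hm⟩ w rfl
    rw [hz] at h
    exact neg_eq_zero.1 h.symm
  obtain ⟨w, hw⟩ := exists_verticalLift_eq (I := I) (p := p) (v := z.1.2) (by
    rw [← mem_prolongationFiber.1 z.2, hb, map_zero])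
  -- Now z is the vertical lift of w; testing it against a vector over each b gives β(w, b) = 0.
  -- Since z is now the second argument, its vanishing is transferred there by alternation.
  have hw0 : w = 0 := hl _ _ fun b => by
    obtain ⟨y, rfl⟩ := exists_mem_prolongationFiber (L := L) (p := p) b
    have h := pairingForm_eval_vertical hs hK hΩ y z w (Prod.ext hb hw)
    have ha := Ω.alternating p (y + z)
    simp only [map_add, LinearMap.add_apply, Ω.alternating, hz, zero_add, add_zero] at ha
    rw [ha] at h
    exact neg_eq_zero.1 h.symm
  rw [hw0, verticalLift_zero] at hw
  exact Subtype.ext (Prod.ext hb hw)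

end Symplectic

end

/-- In (i) the pairing of E* with A = E* is the symplectic form itself; in (ii) the pairing of E*
with A = E is evaluation. The rank is 2n because E and E* both have rank n. -/
theorem mainTheorem4
    {EM : Type*} [NormedAddCommGroup EM] [NormedSpace ℝ EM] [FiniteDimensional ℝ EM]
    {M : Type*} [TopologicalSpace M] [ChartedSpace EM M] [IsManifold 𝓘(ℝ, EM) ∞ M]
    [T2Space M] [SigmaCompactSpace M]
    (F : Type*) [NormedAddCommGroup F] [NormedSpace ℝ F] [FiniteDimensional ℝ F]
    (E : M → Type*) [TopologicalSpace (TotalSpace F E)] [∀ x, TopologicalSpace (E x)]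
    [∀ x, AddCommGroup (E x)] [∀ x, Module ℝ (E x)]
    [∀ x, IsTopologicalAddGroup (E x)] [∀ x, ContinuousSMul ℝ (E x)]
    [FiberBundle F E] [VectorBundle ℝ F E] [ContMDiffVectorBundle ∞ F E 𝓘(ℝ, EM)] :
    -- a symplectic Lie algebroid structure on the dual bundle, prolonged over `E^* → M`
    (∀ L : LieAlgebroid 𝓘(ℝ, EM) (smoothSections 𝓘(ℝ, EM) (F →L[ℝ] ℝ) (DualBundle E)),
      L.IsSymplectic →
      HasSymplecticProlongation (𝓘(ℝ, EM).prod 𝓘(ℝ, F →L[ℝ] ℝ)) L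
        (TotalSpace.proj : TotalSpace (F →L[ℝ] ℝ) (DualBundle E) → M)
        (contMDiff_proj (DualBundle E)) (2 * Module.finrank ℝ F)) ∧
    -- a symplectic Lie algebroid structure on `E`, prolonged over the dual bundle `E^* → M`
    (∀ L : LieAlgebroid 𝓘(ℝ, EM) (smoothSections 𝓘(ℝ, EM) F E),
      L.IsSymplectic →
      HasSymplecticProlongation (𝓘(ℝ, EM).prod 𝓘(ℝ, F →L[ℝ] ℝ)) L
        (TotalSpace.proj : TotalSpace (F →L[ℝ] ℝ) (DualBundle E) → M)
        (contMDiff_proj (DualBundle E)) (2 * Module.finrank ℝ F)) := by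
  have hrank : Module.finrank ℝ (F →L[ℝ] ℝ) = Module.finrank ℝ F :=
    (LinearMap.toContinuousLinearMap (𝕜 := ℝ) (E := F) (F' := ℝ)).finrank_eq.symm.trans
      Subspace.dual_finrank_eq
  constructor
  · rintro L ⟨Ω, hΩ, -⟩
    -- Here p ↦ p is the tautological section of E* along τ, smooth as the identity map, so
    -- smoothness of ω(p, s(p)) is smoothness of a two-form along τ. Right non-degeneracy follows by
    -- expanding ω(w + b, w + b) = 0.
    have h := hasSymplecticProlongation_of_pairing (W := DualBundle E) (G := F →L[ℝ] ℝ) L Ω.toFun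
      (fun s hs => Ω.contMDiff_along (contMDiff_proj (DualBundle E)) contMDiff_id hs)
      (fun x w => hΩ x w) fun x b hb => hΩ x b fun w => by
        have h := Ω.alternating x (w + b)
        simpa [Ω.alternating, hb] using h
    rwa [hrank, ← two_mul] at h
  · rintro L -
    have h := hasSymplecticProlongation_of_pairing (W := DualBundle E) (G := F →L[ℝ] ℝ) L
      (fun x => ContinuousLinearMap.coeLM ℝ) ?_ (fun x w hw => ContinuousLinearMap.ext hw)
      fun x b hb => ?_
    · rwa [hrank, ← two_mul] at h
    · intro s hs
      have h := ContMDiff.clm_bundle_apply (F₁ := F) (F₂ := ℝ) (E₁ := E) (E₂ := Trivial M ℝ)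
        (b := (TotalSpace.proj : TotalSpace (F →L[ℝ] ℝ) (DualBundle E) → M))
        (ϕ := fun p => p.2) contMDiff_id hs
      exact fun p => (contMDiffAt_totalSpace.1 (h p)).2
    -- The fibre of E carries only a topology; the trivialization moves the question to the normed
    -- space F, whose dual separates points.
    · let t := (trivializationAt F E x).continuousLinearEquivAt ℝ x
        (mem_baseSet_trivializationAt F E x)
      refine t.map_eq_zero_iff.1 ((SeparatingDual.eq_iff_forall_dual_eq (R := ℝ)).2 fun l => ?_)
      rw [map_zero]
      exact hb (l ∘L (t : E x →L[ℝ] F))
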